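/- **Classical reversible circuit for QBall$_1$.** Let $0\le r\le n$ be integers and let $F=(C_1,\dots,C_L)$ be a 3-SAT formula over variables $x_1,\dots,x_n$, i.e. an ordered list of clauses with at most three literals each. *The set $V(\vec s)$.* For a set $V$ of positive integers let $x(V)$ be the assignment that sets $x_a$ to $1$ if $a\in V$ and to $0$ otherwise. For $\vec s=(s_1,\dots,s_r)\in\{1,2,3\}^r$ put $V_0=\emptyset$, and for $i=1,\dots,r$ put $V_i=V_{i-1}\cup\{v_i\}$, where $v_i$ is the $s_i$-th smallest index, not in $V_{i-1}$, of a variable of the first clause of $F$ that is not satisfied by $x(V_{i-1})$; if there is no such clause or no such index, $v_i=n+i$ (a dummy variable). Let $V(\vec s)=V_r=\{v_1,\dots,v_r\}$. *The encoding.* For a set $S=\{y_1<\dots<y_k\}$ of positive integers, $|\mathrm{enc}\,S\rangle$ is a register of $\lceil k\log_2(n/k)\rceil+4k$ trits that contains the numbers $y_1,\,y_2-y_1,\dots,y_k-y_{k-1}$ in binary without leading zeros, each followed by a separation character (the third symbol of the trit), and then zeros. If $r=2^{e_1}+\dots+2^{e_m}$ with $e_1>\dots>e_m$, cut $v_1,\dots,v_r$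 into consecutive blocks $B_1,\dots,B_m$ with $|B_j|=2^{e_j}$, and let $|\mathrm{EffEnc}\,V(\vec s)\rangle=|\mathrm{enc}\,B_1\rangle\cdots|\mathrm{enc}\,B_m\rangle$. Every trit, also of $\vec s$, is stored in two bits, the symbol $0$ as $00$. *Reversible implementation.* A bijection $f$ of $\{0,1\}^q$ can be implemented reversibly using $l$ ancillas and $g$ gates if some circuit of at most $g$ gates, each a NOT, CNOT or Toffoli gate, maps $|x\rangle|0\rangle^{\otimes l}$ to $|f(x)\rangle|0\rangle^{\otimes l}$ for all $x\in\{0,1\}^q$. **Claim.** The map $|\vec s\rangle|0\rangle\mapsto|\vec s\rangle|\mathrm{EffEnc}\,V(\vec s)\rangle$ can be implemented reversibly using $O(r\log(n/r)+r+\log n)$ ancillas and $O(\mathrm{poly}(n))$ gates, and the $\mathrm{EffEnc}$ register itself has $O(r\log(n/r)+r)$ bits. That is, there are constants $K,A,d$, independent of $n$, $r$ and $F$ (and of the number $L$ of clauses), such that for all $r\le n$ and all $F$ the $\mathrm{EffEnc}$ register has at most $K(r\log_2(n/r)+r)$ bits, and there is a bijection $f$ of the bit strings of the two registers with $f(\vec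 s,0)=(\vec s,\mathrm{EffEnc}\,V(\vec s))$ for all $\vec s\in\{1,2,3\}^r$ that can be implemented reversibly using at most $K(r\log_2(n/r)+r+\log_2 n)$ ancillas and at most $A\,n^d$ gates. (Here $r\log_2(n/r)=0$ for $r=0$, and $\log_2 n$ is read as $0$ for $n=0$.) -/

import Mathlib

namespace QBall

/-! ### Reversible circuits -/

/-- Elementary gates of a classical reversible circuit on `m` bits: NOT, CNOT, Toffoli.  In each
case the last wire `t` is the target and it differs from the control wires. -/
inductive Gate (m : ℕ) where
  | not (t : Fin m)
  | cnot (c t : Fin m) (h : c ≠ t)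
  | toffoli (c₁ c₂ t : Fin m) (h₁₂ : c₁ ≠ c₂) (h₁ : c₁ ≠ t) (h₂ : c₂ ≠ t)

/-- The action of a gate on bit strings. -/
def Gate.apply {m : ℕ} : Gate m → (Fin m → Bool) → (Fin m → Bool)
  | .not t, x => Function.update x t (!x t)
  | .cnot c t _, x => Function.update x t (xor (x t) (x c))
  | .toffoli c₁ c₂ t _ _ _, x => Function.update x t (xor (x t) (x c₁ && x c₂))

/-- A circuit is a sequence of gates, run from left to right; its size is its length. -/
abbrev Circuit (m : ℕ) := List (Gate m)

/-- The map computed by a circuit. -/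
def Circuit.run {m : ℕ} (c : Circuit m) (x : Fin m → Bool) : Fin m → Bool :=
  c.foldl (fun y g => g.apply y) x

/-- The all-zero register of `m` bits. -/
def zeros (m : ℕ) : Fin m → Bool := fun _ => false

/-- The bijection `f` of `{0,1}^q` can be implemented reversibly using `l` ancillas and `g` gates:
some circuit with at most `g` elementary gates maps `|x⟩|0^l⟩` to `|f x⟩|0^l⟩` for every `x`. -/
def ImplementableReversibly {q : ℕ} (f : Equiv.Perm (Fin q → Bool)) (l g : ℕ) : Prop :=
  ∃ c : Circuit (q + l), c.length ≤ g ∧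
    ∀ x : Fin q → Bool, c.run (Fin.append x (zeros l)) = Fin.append (f x) (zeros l)

/-! ### Formulas and the non-recursive form of the ball search -/

/-- A clause with at most three literals over the variables `x_1, …, x_n`.  The variable `x_a` is
represented by `a - 1 : Fin n`; the literal `(x, true)` is `x` and `(x, false)` is its negation. -/
structure Clause (n : ℕ) where
  lits : Finset (Fin n × Bool)
  card_le : lits.card ≤ 3

/-- A 3-SAT formula: a list of clauses, in their predefined order. -/
abbrev Formula (n : ℕ) := List (Clause n)

/-- The index in `{1, …, n}` of a variable. -/
def index {n : ℕ} (x : Fin n) : ℕ := x.val + 1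

/-- The assignment `x(V)`: variables with index in `V` are set to `1`, all others to `0`. -/
def assignment (n : ℕ) (V : Finset ℕ) : Fin n → Bool := fun x => decide (index x ∈ V)

/-- Whether a clause is satisfied by an assignment. -/
def Clause.sat {n : ℕ} (C : Clause n) (a : Fin n → Bool) : Bool :=
  decide (∃ p ∈ C.lits, a p.1 = p.2)

/-- The indices of the variables that occur in a clause. -/
def Clause.vars {n : ℕ} (C : Clause n) : Finset ℕ := C.lits.image fun p => index p.1

/-- The variable added to `V` in round `i`.  Let `C` be the first clause of `F` that `x(V)` does
not satisfy.  The choice `c : Fin 3`, which stands for `c + 1 ∈ {1, 2, 3}`, selects the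
`(c+1)`-st smallest index of a variable of `C` that is not in `V`.  If there is no such index, or
no such clause, the dummy variable `n + i` is taken. -/
def nextVar {n : ℕ} (F : Formula n) (V : Finset ℕ) (i : ℕ) (c : Fin 3) : ℕ :=
  match F.find? (fun C => !C.sat (assignment n V)) with
  | some C => ((C.vars \ V).sort (· ≤ ·)).getD c (n + i)
  | none => n + i

/-- The list `v_1, …, v_r` of the variables selected by the choices `s_1, …, s_r`. -/
def flipList {n : ℕ} (F : Formula n) (s : List (Fin 3)) : List ℕ :=
  s.foldl (fun v c => v ++ [nextVar F v.toFinset (v.length + 1) c]) []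

/-! ### Encoding of sets by relative shifts -/

/-- `shifts p [y_1, …, y_k] = [y_1 - p, y_2 - y_1, …, y_k - y_{k-1}]`. -/
def shifts : ℕ → List ℕ → List ℕ
  | _, [] => []
  | p, y :: ys => (y - p) :: shifts y ys

/-- The binary digits of a number without leading zeros, most significant digit first, followed by
the separation character.  Trits are elements of `Fin 3`, and `2` is the separation character. -/
def encNat (d : ℕ) : List (Fin 3) :=
  (Nat.bits d).reverse.map (fun b => if b then 1 else 0) ++ [2]

/-- The trit string encoding `S = {y_1 < … < y_k}` by `y_1, y_2 - y_1, …, y_k - y_{k-1}`. -/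
def encSet (S : Finset ℕ) : List (Fin 3) :=
  (shifts 0 (S.sort (· ≤ ·))).flatMap encNat

/-- The number `⌈k log₂ (n/k)⌉ + 4k` of trits of the register for a set of size `k`. -/
noncomputable def encLen (n k : ℕ) : ℕ := ⌈(k : ℝ) * Real.logb 2 ((n : ℝ) / k)⌉₊ + 4 * k

/-- The content `|enc S⟩` of the register for `S`: its encoding, followed by zeros. -/
noncomputable def encReg (n : ℕ) (S : Finset ℕ) : List (Fin 3) :=
  (encSet S).rightpad (encLen n S.card) 0

/-- The powers of two in the binary expansion of `r`, in descending order. -/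
def blockSizes (r : ℕ) : List ℕ := (Nat.bitIndices r).reverse.map (2 ^ ·)

/-- The number of trits of the register holding `EffEnc V` for `|V| = r`. -/
noncomputable def effEncLen (n r : ℕ) : ℕ := ((blockSizes r).map (encLen n)).sum

/-- `|EffEnc V(s)⟩`: the list `v_1, …, v_r` is cut into consecutive blocks whose sizes are the
powers of two in the binary expansion of `r`, in descending order, and each block is encoded as a
set in a register of its own. -/
noncomputable def effEnc {n : ℕ} (F : Formula n) (s : List (Fin 3)) : List (Fin 3) :=
  ((blockSizes s.length).splitLengths (flipList F s)).flatMap fun B => encReg n B.toFinset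

/-- A trit is stored in two bits: `0 ↦ 00`, `1 ↦ 10`, `2 ↦ 01`. -/
def tritBits (t : Fin 3) : List Bool := [decide (t = 1), decide (t = 2)]

/-- The register of `2 w` bits that stores a string of `w` trits. -/
def tritReg (w : ℕ) (t : List (Fin 3)) : Fin (2 * w) → Bool :=
  fun i => (t.flatMap tritBits).getD i false

/-! ### The registers have the right size -/

theorem length_shifts (p : ℕ) (l : List ℕ) : (shifts p l).length = l.length := by
  induction l generalizing p with
  | nil => rfl
  | cons y ys ih => simp [shifts, ih]

theorem shifts_pos_sum {M : ℕ} (p : ℕ) (l : List ℕ) (hp : p ≤ M)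
    (hl : (p :: l).Pairwise (· < ·)) (hM : ∀ y ∈ l, y ≤ M) :
    (∀ d ∈ shifts p l, 0 < d) ∧ (shifts p l).sum ≤ M - p := by
  induction l generalizing p with
  | nil => simp [shifts]
  | cons y ys ih =>
    have h1 := List.pairwise_cons.1 hl
    have hpy : p < y := h1.1 y (by simp)
    have hy : y ≤ M := hM y (by simp)
    obtain ⟨ha, hb⟩ := ih y hy h1.2 (fun z hz => hM z (by simp [hz]))
    refine ⟨?_, ?_⟩
    · intro d hd
      simp only [shifts, List.mem_cons] at hd
      rcases hd with rfl | hd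
      · omega
      · exact ha d hd
    · simp only [shifts, List.sum_cons]
      omega

theorem length_flatMap_encNat_le {n k : ℕ} (hk : 0 < k) (hkn : k ≤ n) (D : List ℕ)
    (hpos : ∀ d ∈ D, 0 < d) :
    ((D.flatMap encNat).length : ℝ) ≤
      D.length * (Real.logb 2 ((n : ℝ) / k) + 3 - 1 / Real.log 2) +
        D.sum * (k / (2 * n * Real.log 2)) := by
  have hn : (0 : ℝ) < n := by exact_mod_cast hk.trans_le hkn
  have hk' : (0 : ℝ) < k := by exact_mod_cast hk
  have hlog : 0 < Real.log 2 := Real.log_pos (by norm_num)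
  induction D with
  | nil => simp
  | cons d D ih =>
    have ih' := ih (fun e he => hpos e (by simp [he]))
    have hd : 0 < d := hpos d (by simp)
    have hd' : (0 : ℝ) < d := by exact_mod_cast hd
    have hlen : (encNat d).length = d.size + 1 := by simp [encNat, Nat.size_eq_bits_len]
    have hsize : (d.size : ℝ) ≤ Real.logb 2 d + 1 := by
      obtain ⟨m, hm⟩ : ∃ m, d.size = m + 1 :=
        ⟨d.size - 1, by have := Nat.size_pos.2 hd; omega⟩
      have h2 : 2 ^ m ≤ d := Nat.lt_size.1 (by omega)
      have h3 : (m : ℝ) ≤ Real.logb 2 d := by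
        rw [Real.le_logb_iff_rpow_le (by norm_num) hd', Real.rpow_natCast]
        exact_mod_cast h2
      rw [hm]; push_cast; linarith
    have htan : Real.logb 2 d ≤
        Real.logb 2 ((n : ℝ) / k) + 1 + (d * (k / (2 * n * Real.log 2)) - 1 / Real.log 2) := by
      have h4 := Real.log_le_sub_one_of_pos (x := (d : ℝ) * k / (2 * n)) (by positivity)
      have h5 : Real.log ((d : ℝ) * k / (2 * n)) =
          Real.log d - Real.log 2 - Real.log ((n : ℝ) / k) := by
        rw [Real.log_div (by positivity) (by positivity), Real.log_mul (by positivity)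
          (by positivity), Real.log_mul (by positivity) (by positivity),
          Real.log_div (by positivity) (by positivity)]
        ring
      have h6 : Real.log d ≤ Real.log ((n : ℝ) / k) + Real.log 2 + (d * k / (2 * n) - 1) := by
        linarith
      have h7 := div_le_div_of_nonneg_right h6 hlog.le
      simp only [Real.logb]
      refine h7.trans (le_of_eq ?_)
      field_simp
    rw [List.flatMap_cons, List.length_append, hlen, List.length_cons, List.sum_cons]
    simp only [Nat.cast_add, Nat.cast_one]
    nlinarith

/-- The encoding of a set of `k ≤ n` indices in `{1, …, 2n}` fits into its register. -/
theorem length_encSet_le {n : ℕ} (S : Finset ℕ) (hS : ∀ y ∈ S, 0 < y ∧ y ≤ 2 * n)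
    (hcard : S.card ≤ n) : (encSet S).length ≤ encLen n S.card := by
  rcases Nat.eq_zero_or_pos S.card with h0 | hk
  · rw [Finset.card_eq_zero] at h0
    subst h0
    simp [encSet, shifts]
  have hlog : 0 < Real.log 2 := Real.log_pos (by norm_num)
  have hn : (0 : ℝ) < n := by exact_mod_cast hk.trans_le hcard
  have hpw : (0 :: S.sort (· ≤ ·)).Pairwise (· < ·) := by
    refine List.pairwise_cons.2 ⟨fun y hy => (hS y (by simpa using hy)).1, ?_⟩
    exact (Finset.sortedLT_sort S).pairwise
  obtain ⟨hpos, hsum⟩ := shifts_pos_sum (M := 2 * n) 0 (S.sort (· ≤ ·)) (Nat.zero_le _) hpw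
    (fun y hy => (hS y (by simpa using hy)).2)
  have h := length_flatMap_encNat_le hk hcard _ hpos
  rw [length_shifts, Finset.length_sort] at h
  have hsum' : ((shifts 0 (S.sort (· ≤ ·))).sum : ℝ) ≤ 2 * n := by exact_mod_cast hsum
  have h1 : ((shifts 0 (S.sort (· ≤ ·))).sum : ℝ) * (S.card / (2 * n * Real.log 2)) ≤
      2 * n * (S.card / (2 * n * Real.log 2)) :=
    mul_le_mul_of_nonneg_right hsum' (by positivity)
  have h2 : 2 * (n : ℝ) * (S.card / (2 * n * Real.log 2)) = S.card * (1 / Real.log 2) := by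
    field_simp
  have h3 := Nat.le_ceil ((S.card : ℝ) * Real.logb 2 ((n : ℝ) / S.card))
  have h4 : ((encSet S).length : ℝ) ≤ (encLen n S.card : ℝ) := by
    unfold encSet encLen
    push_cast
    have : (0 : ℝ) ≤ S.card := by positivity
    nlinarith
  exact_mod_cast h4

theorem nextVar_spec {n : ℕ} (F : Formula n) (V : Finset ℕ) (i : ℕ) (c : Fin 3) :
    nextVar F V i c = n + i ∨
      (nextVar F V i c ∉ V ∧ 0 < nextVar F V i c ∧ nextVar F V i c ≤ n) := by
  unfold nextVar
  split
  · rename_i C _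
    by_cases h : (c : ℕ) < ((C.vars \ V).sort (· ≤ ·)).length
    · right
      rw [List.getD_eq_getElem _ _ h]
      have hm := List.getElem_mem h
      rw [Finset.mem_sort, Finset.mem_sdiff] at hm
      refine ⟨hm.2, ?_⟩
      obtain ⟨p, _, hp⟩ := Finset.mem_image.1 hm.1
      rw [← hp]
      have := p.1.isLt
      unfold index
      omega
    · left
      rw [List.getD_eq_default _ _ (by omega)]
  · exact Or.inl rfl

/-- The selected variables are distinct, one per round, with indices in `{1, …, n + r}`. -/
theorem flipList_spec {n : ℕ} (F : Formula n) (s : List (Fin 3)) :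
    (flipList F s).length = s.length ∧ (flipList F s).Nodup ∧
      ∀ y ∈ flipList F s, 0 < y ∧ y ≤ n + s.length := by
  induction s using List.reverseRecOn with
  | nil => simp [flipList]
  | append_singleton s c ih =>
    obtain ⟨h1, h2, h3⟩ := ih
    have hstep : flipList F (s ++ [c]) = flipList F s ++
        [nextVar F (flipList F s).toFinset ((flipList F s).length + 1) c] := by
      simp [flipList]
    have hv := nextVar_spec F (flipList F s).toFinset ((flipList F s).length + 1) c
    rw [hstep]
    generalize nextVar F (flipList F s).toFinset ((flipList F s).length + 1) c = v at hv
    have hnot : v ∉ flipList F s := by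
      rcases hv with hv | hv
      · intro hmem
        have := (h3 v hmem).2
        omega
      · simpa using hv.1
    refine ⟨by simp [h1], ?_, ?_⟩
    · rw [List.nodup_append]
      refine ⟨h2, by simp, ?_⟩
      intro a ha b hb
      rw [List.mem_singleton] at hb
      subst hb
      exact fun hab => hnot (hab ▸ ha)
    · intro y hy
      rw [List.mem_append, List.mem_singleton] at hy
      rw [List.length_append, List.length_singleton]
      rcases hy with hy | rfl
      · have := h3 y hy
        omega
      · omega

theorem sum_blockSizes (r : ℕ) : (blockSizes r).sum = r := by
  unfold blockSizes
  rw [List.map_reverse, List.sum_reverse, Nat.sum_map_two_pow_bitIndices]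

/-- For `r ≤ n` rounds, `EffEnc V(s)` fills its register of `effEncLen n r` trits exactly. -/
theorem length_effEnc {n : ℕ} (F : Formula n) (s : List (Fin 3)) (h : s.length ≤ n) :
    (effEnc F s).length = effEncLen n s.length := by
  obtain ⟨h1, h2, h3⟩ := flipList_spec F s
  have hlen := List.map_splitLengths_length (flipList F s) (blockSizes s.length)
    (by rw [sum_blockSizes, h1])
  have hflat := List.flatten_splitLengths (flipList F s) (blockSizes s.length)
    (by rw [sum_blockSizes, h1])
  unfold effEnc effEncLen
  rw [List.length_flatMap]
  conv_rhs => rw [← hlen, List.map_map]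
  congr 1
  refine List.map_congr_left fun B hB => ?_
  have hsub : B.Sublist (flipList F s) := by
    rw [← hflat]
    exact List.sublist_flatten_of_mem hB
  have hBc : B.toFinset.card = B.length := List.toFinset_card_of_nodup (h2.sublist hsub)
  have hle : B.length ≤ n := hsub.length_le.trans (h1 ▸ h)
  have hfit := length_encSet_le (n := n) B.toFinset
    (fun y hy => by
      have := h3 y (hsub.subset (List.mem_toFinset.1 hy))
      omega) (by omega)
  simp only [encReg, List.length_rightpad, Function.comp]
  rw [max_eq_left hfit, hBc]

end QBall

/-! The proof rests on two devices: one makes all local computations cheap in space, the other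
organises the rounds.

Local computations. Decoding a register, finding the first unsatisfied clause, choosing a variable
in it and encoding a set can all be written with a bounded number of nested layers of counting: "the
weighted number of true predicates in a family of total weight below `2 ^ w` is `k`". `HasDepth`
records the number of layers. A layer is evaluated serially: compute a subpredicate into a flag,
increment a counter, erase the flag; at the end compare the counter with `k` and undo the counting.
Each layer adds `2 * w + 1` clean wires and a factor `2 ^ (8 * w)` of gates (`HasDepth.countP_eq`).
Depth 31 suffices, and `w = O(log n)`, so `O(log n)` ancillas and polynomially many gates are
enough. The length of `F` plays no role, because only polynomially many different clauses exist
(`card_clauses_le`).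

Rounds (`exists_block`). For a block of `2 ^ (e + 1)` rounds, compute both halves into scratch
registers, the second half reading the register of the first. Then write the encoding of the union
to the output, and run the half circuits again to erase the scratch. The halves share their
workspace, so a level costs only two registers of half size; these sizes sum to `O(r log (n / r) +
r)` (`sum_encLen_le`). The half circuits run four times per level, which gives a factor at most `8 ^
e ≤ n ^ 3` overall. `exists_blocks` chains the blocks of the binary expansion of `r`, with earlier
output registers as inputs of later blocks.

Ancillas have to come back clean for every input, also for one that encodes nothing. Therefore each
circuit adds a total function of the state to its output, and decoding is defined on all bit
strings. Correctness is claimed only for meaningful input. Reversibility then turns the circuit into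
a bijection (`exists_perm`). -/

namespace QBall

/-! ### Circuits on wires numbered by natural numbers -/

/-- A NOT, CNOT or Toffoli gate on wires numbered by natural numbers. -/
inductive WireGate where
  | not (t : ℕ)
  | cnot (c t : ℕ)
  | toffoli (c₁ c₂ t : ℕ)

/-- The action of a gate on the values of all wires. -/
def WireGate.apply : WireGate → (ℕ → Bool) → (ℕ → Bool)
  | .not t, x => Function.update x t (!x t)
  | .cnot c t, x => Function.update x t (xor (x t) (x c))
  | .toffoli c₁ c₂ t, x => Function.update x t (xor (x t) (x c₁ && x c₂))

/-- The wires of the gate are distinct and smaller than `m`. -/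
def WireGate.Ok (m : ℕ) : WireGate → Prop
  | .not t => t < m
  | .cnot c t => c < m ∧ t < m ∧ c ≠ t
  | .toffoli c₁ c₂ t => c₁ < m ∧ c₂ < m ∧ t < m ∧ c₁ ≠ c₂ ∧ c₁ ≠ t ∧ c₂ ≠ t

theorem WireGate.Ok.mono {m m' : ℕ} (h : m ≤ m') {g : WireGate} (hg : g.Ok m) : g.Ok m' := by
  cases g <;> simp only [WireGate.Ok] at * <;> omega

/-- The action of a sequence of gates, run from left to right. -/
def runWires (c : List WireGate) (x : ℕ → Bool) : ℕ → Bool :=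
  c.foldl (fun y g => g.apply y) x

@[simp] theorem runWires_nil (x : ℕ → Bool) : runWires [] x = x := rfl

@[simp] theorem runWires_cons (g : WireGate) (c : List WireGate) (x : ℕ → Bool) :
    runWires (g :: c) x = runWires c (g.apply x) := rfl

@[simp] theorem runWires_append (c c' : List WireGate) (x : ℕ → Bool) :
    runWires (c ++ c') x = runWires c' (runWires c x) := by
  simp [runWires]

theorem WireGate.apply_apply {m : ℕ} {g : WireGate} (hg : g.Ok m) (x : ℕ → Bool) :
    g.apply (g.apply x) = x := by
  funext i
  cases g <;> simp only [WireGate.Ok] at hg <;> simp only [WireGate.apply, Function.update_apply]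
  · split_ifs <;> simp_all
  · have := hg.2.2
    split_ifs <;> simp_all
  · have h1 := hg.2.2.2.2.1
    have h2 := hg.2.2.2.2.2
    split_ifs <;> simp_all

theorem runWires_reverse {m : ℕ} {c : List WireGate} (hc : ∀ g ∈ c, g.Ok m) (x : ℕ → Bool) :
    runWires c.reverse (runWires c x) = x := by
  induction c generalizing x with
  | nil => rfl
  | cons g c ih =>
    simp only [List.mem_cons, forall_eq_or_imp] at hc
    rw [List.reverse_cons, runWires_append, runWires_cons g c, ih hc.2]
    exact WireGate.apply_apply hc.1 x

/-- A circuit whose wires are smaller than `m` acts as a circuit on `m` bits. -/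
theorem exists_circuit {m : ℕ} (c : List WireGate) (hc : ∀ g ∈ c, g.Ok m) :
    ∃ c' : Circuit m, c'.length = c.length ∧
      ∀ x : ℕ → Bool, c'.run (fun i => x i) = fun i : Fin m => runWires c x i := by
  induction c with
  | nil => exact ⟨[], rfl, fun x => rfl⟩
  | cons g c ih =>
    simp only [List.mem_cons, forall_eq_or_imp] at hc
    obtain ⟨c', hl, hrun⟩ := ih hc.2
    obtain ⟨g', hg'⟩ : ∃ g' : Gate m, ∀ x : ℕ → Bool,
        g'.apply (fun i => x i) = fun i : Fin m => g.apply x i := by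
      have key : ∀ (x : ℕ → Bool) (t : Fin m) (b : Bool),
          Function.update (fun i : Fin m => x i) t b =
            fun i : Fin m => Function.update x t b i := by
        intro x t b
        funext i
        simp [Function.update_apply, Fin.ext_iff]
      cases g with
      | not t => exact ⟨.not ⟨t, hc.1⟩, fun x => key _ _ _⟩
      | cnot a t =>
        obtain ⟨h1, h2, h3⟩ := hc.1
        exact ⟨.cnot ⟨a, h1⟩ ⟨t, h2⟩ (by simpa using h3), fun x => key _ _ _⟩
      | toffoli a b t =>
        obtain ⟨h1, h2, h3, h4, h5, h6⟩ := hc.1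
        exact ⟨.toffoli ⟨a, h1⟩ ⟨b, h2⟩ ⟨t, h3⟩ (by simpa using h4) (by simpa using h5)
          (by simpa using h6), fun x => key _ _ _⟩
    refine ⟨g' :: c', by simp [hl], fun x => ?_⟩
    have : Circuit.run (g' :: c') (fun i => x i) = c'.run (g'.apply (fun i => x i)) := rfl
    rw [this, hg', hrun, runWires_cons]

/-! ### Counters -/

/-- Write the `w` lowest binary digits of `v` to the wires `c, …, c + w - 1`. -/
def writeNum (c w v : ℕ) (x : ℕ → Bool) : ℕ → Bool :=
  fun i => if c ≤ i ∧ i < c + w then v.testBit (i - c) else x i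

theorem writeNum_zero_of_clean {c w : ℕ} {x : ℕ → Bool}
    (hx : ∀ i, c ≤ i → i < c + w → x i = false) : writeNum c w 0 x = x := by
  funext i
  unfold writeNum
  split_ifs with h
  · rw [hx i h.1 h.2, Nat.zero_testBit]
  · rfl

theorem writeNum_zero_width (c v : ℕ) (x : ℕ → Bool) : writeNum c 0 v x = x :=
  funext fun _ => if_neg (by omega)

/-- Splits off the lowest digit and moves it into the background state; both inductions on the
counter width start with this. -/
theorem writeNum_succ (c w v : ℕ) (x : ℕ → Bool) :
    writeNum c (w + 1) v x =
      writeNum (c + 1) w (v / 2) (Function.update x c (v.testBit 0)) := by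
  funext i
  unfold writeNum
  rcases lt_trichotomy i c with h | h | h
  · rw [if_neg (by omega), if_neg (by omega), Function.update_of_ne (by omega)]
  · subst h
    rw [if_pos (by omega), if_neg (by omega)]
    simp
  · by_cases h' : i < c + (w + 1)
    · rw [if_pos (by omega), if_pos (by omega), Nat.testBit_div_two]
      congr 1
      omega
    · rw [if_neg (by omega), if_neg (by omega), Function.update_of_ne (by omega)]

theorem writeNum_of_lt {c w v i : ℕ} {x : ℕ → Bool} (h : i < c) :
    writeNum c w v x i = x i := if_neg (by omega)

theorem writeNum_of_le {c w v i : ℕ} {x : ℕ → Bool} (h : c + w ≤ i) :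
    writeNum c w v x i = x i := if_neg (by omega)

theorem writeNum_update {c w v i : ℕ} {x : ℕ → Bool} {b : Bool} (h : i < c ∨ c + w ≤ i) :
    writeNum c w v (Function.update x i b) = Function.update (writeNum c w v x) i b := by
  funext j
  unfold writeNum
  simp only [Function.update_apply]
  split_ifs <;> first | rfl | omega

/-- Increment the counter on the `w` wires from `c` on if the control wire `φ` is on, with carries
on the `w` wires from `a` on. -/
def increment (φ c a : ℕ) : ℕ → List WireGate
  | 0 => []
  | w + 1 => [.toffoli φ c a] ++ increment a (c + 1) (a + 1) w ++ [.toffoli φ c a, .cnot φ c]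

theorem length_increment (φ c a w : ℕ) : (increment φ c a w).length = 3 * w := by
  induction w generalizing φ c a with
  | zero => rfl
  | succ w ih => simp [increment, ih]; omega

theorem increment_ok {φ c a w m : ℕ} (h1 : φ < c) (h2 : c + w ≤ a) (h3 : a + w ≤ m) :
    ∀ g ∈ increment φ c a w, g.Ok m := by
  -- In the recursion the control is a carry wire, which lies above the counter, so the position of
  -- `φ` has to be generalised.
  have key : ∀ (w φ c a : ℕ), (φ < c ∨ c + w ≤ φ) → φ < a → c + w ≤ a → a + w ≤ m →
      ∀ g ∈ increment φ c a w, g.Ok m := by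
    intro w
    induction w with
    | zero => simp [increment]
    | succ w ih =>
      intro φ c a h1 h1' h2 h3 g hg
      simp only [increment, List.mem_append, List.mem_cons, List.not_mem_nil, or_false] at hg
      rcases hg with (rfl | hg) | rfl | rfl
      · simp only [WireGate.Ok]; omega
      · exact ih a (c + 1) (a + 1) (by omega) (by omega) (by omega) (by omega) g hg
      · simp only [WireGate.Ok]; omega
      · simp only [WireGate.Ok]; omega
  exact key w φ c a (Or.inl h1) (by omega) h2 h3

/-- Control and lowest digit produce the carry, which controls the increment of the upper digits.
The carry is erased before the lowest digit flips, while it can still be recomputed. Overflow is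
dropped by `writeNum`. -/
theorem run_increment (w φ c a v : ℕ) (x : ℕ → Bool) (h1 : φ < c ∨ c + w ≤ φ) (h1' : φ < a)
    (h2 : c + w ≤ a) (hx : ∀ i, a ≤ i → i < a + w → x i = false) :
    runWires (increment φ c a w) (writeNum c w v x) = writeNum c w (v + (x φ).toNat) x := by
  induction w generalizing φ c a v x with
  | zero => simp [increment, writeNum_zero_width]
  | succ w ih =>
    have hφc : φ ≠ c := by omega
    have hφa : φ ≠ a := by omega
    have hca : c ≠ a := by omega
    have hw1 : c < c + 1 ∨ c + 1 + w ≤ c := Or.inl (by omega)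
    have hw2 : a < c + 1 ∨ c + 1 + w ≤ a := Or.inr (by omega)
    have hw3 : φ < c + 1 ∨ c + 1 + w ≤ φ := by omega
    have hrd : ∀ (u : ℕ) (y : ℕ → Bool) (i : ℕ), (i < c + 1 ∨ c + 1 + w ≤ i) →
        writeNum (c + 1) w u y i = y i := by
      intro u y i h
      exact if_neg (by omega)
    have hxa : x a = false := hx a le_rfl (by omega)
    have step1 : WireGate.apply (.toffoli φ c a) (writeNum c (w + 1) v x) =
        writeNum (c + 1) w (v / 2) (Function.update (Function.update x c (v.testBit 0)) a
          (x φ && v.testBit 0)) := by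
      rw [writeNum_succ, writeNum_update hw2]
      simp only [WireGate.apply]
      rw [hrd _ _ _ hw1, hrd _ _ _ hw2, hrd _ _ _ hw3]
      simp [Function.update_of_ne hφc, Function.update_of_ne hca.symm, hxa]
    rw [increment, runWires_append, runWires_append, runWires_cons _ [], runWires_nil, step1,
      ih a (c + 1) (a + 1) _ _ (by omega) (by omega) (by omega) (by
        intro i hi hi'
        rw [Function.update_of_ne (by omega), Function.update_of_ne (by omega)]
        exact hx i (by omega) (by omega))]
    rw [writeNum_succ c w (v + _)]
    have hdiv : (v + (x φ).toNat) / 2 = v / 2 + (x φ && v.testBit 0).toNat := by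
      rw [Nat.testBit_zero]
      cases x φ
      · simp
      · rcases Nat.mod_two_eq_zero_or_one v with h | h <;> simp [h] <;> omega
    have hbit : (v + (x φ).toNat).testBit 0 = xor (v.testBit 0) (x φ) := by
      rw [Nat.testBit_zero, Nat.testBit_zero]
      cases x φ
      · simp
      · rcases Nat.mod_two_eq_zero_or_one v with h | h <;> simp [Nat.add_mod, h]
    rw [hdiv, hbit]
    simp only [Function.update_self, runWires_cons, runWires_nil, WireGate.apply]
    rw [← writeNum_update hw2, ← writeNum_update hw1, hrd _ _ _ hw1, hrd _ _ _ hw1,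
      hrd _ _ _ hw2, hrd _ _ _ hw3, hrd _ _ _ hw3]
    congr 1
    funext i
    simp only [Function.update_apply]
    by_cases hic : i = c
    · subst hic; simp [hca, hφc, hφa]
    · by_cases hia : i = a
      · subst hia; simp [hic, hxa, hφc, hφa, hca]
      · simp [hic, hia]

/-- If the wire `φ` is on, flip the wire `t` if the counter on the `w` wires from `c` on has the
value `v` modulo `2 ^ w`, with ancillas on the `w` wires from `a` on. -/
def checkNum (t φ c a v : ℕ) : ℕ → List WireGate
  | 0 => [.cnot φ t]
  | w + 1 => (if v.testBit 0 then [] else [.not c]) ++ [.toffoli φ c a] ++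
      checkNum t a (c + 1) (a + 1) (v / 2) w ++ [.toffoli φ c a] ++
      (if v.testBit 0 then [] else [.not c])

theorem length_checkNum_le (t φ c a v w : ℕ) : (checkNum t φ c a v w).length ≤ 4 * w + 1 := by
  induction w generalizing φ c a v with
  | zero => simp [checkNum]
  | succ w ih =>
    have := ih a (c + 1) (a + 1) (v / 2)
    simp only [checkNum]
    split_ifs <;> simp <;> omega

theorem checkNum_ok {m : ℕ} (w t φ c a v : ℕ) (ht : t < c) (htφ : t ≠ φ)
    (h1 : φ < c ∨ c + w ≤ φ) (h1' : φ < a) (h2 : c + w ≤ a) (h3 : a + w ≤ m) :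
    ∀ g ∈ checkNum t φ c a v w, g.Ok m := by
  induction w generalizing φ c a v with
  | zero =>
    intro g hg
    simp only [checkNum, List.mem_singleton] at hg
    subst hg
    simp only [WireGate.Ok]; omega
  | succ w ih =>
    intro g hg
    simp only [checkNum, List.mem_append, List.mem_singleton] at hg
    have hnot : g ∈ (if v.testBit 0 then [] else [WireGate.not c]) → g.Ok m := by
      intro h
      split_ifs at h
      · simp at h
      · rw [List.mem_singleton] at h
        subst h
        simp only [WireGate.Ok]; omega
    rcases hg with (((hg | rfl) | hg) | rfl) | hg
    · exact hnot hg
    · simp only [WireGate.Ok]; omega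
    · exact ih a (c + 1) (a + 1) _ (by omega) (by omega) (by omega) (by omega) (by omega)
        (by omega) g hg
    · simp only [WireGate.Ok]; omega
    · exact hnot hg

/-- A digit wire is negated where the digit of `v` is `0`, so the Toffoli chain along the ancillas
accumulates the conjunction of `φ` with all digit matches. Only the innermost CNOT touches `t`;
everything else is undone in mirror order. -/
theorem run_checkNum (w t φ c a v u : ℕ) (x : ℕ → Bool) (ht : t < c) (htφ : t ≠ φ)
    (h1 : φ < c ∨ c + w ≤ φ) (h1' : φ < a) (h2 : c + w ≤ a)
    (hx : ∀ i, a ≤ i → i < a + w → x i = false) :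
    runWires (checkNum t φ c a v w) (writeNum c w u x) =
      writeNum c w u
        (Function.update x t (xor (x t) (x φ && decide (u % 2 ^ w = v % 2 ^ w)))) := by
  induction w generalizing φ c a v u x with
  | zero => simp [checkNum, writeNum_zero_width, WireGate.apply, Nat.mod_one]
  | succ w ih =>
    have hφc : φ ≠ c := by omega
    have hφa : φ ≠ a := by omega
    have hca : c ≠ a := by omega
    have htc : t ≠ c := by omega
    have hta : t ≠ a := by omega
    have hxa : x a = false := hx a le_rfl (by omega)
    have hw1 : c < c + 1 ∨ c + 1 + w ≤ c := Or.inl (by omega)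
    have hw2 : a < c + 1 ∨ c + 1 + w ≤ a := Or.inr (by omega)
    have hw3 : φ < c + 1 ∨ c + 1 + w ≤ φ := by omega
    have hrd : ∀ (u : ℕ) (y : ℕ → Bool) (i : ℕ), (i < c + 1 ∨ c + 1 + w ≤ i) →
        writeNum (c + 1) w u y i = y i := by
      intro u y i h
      exact if_neg (by omega)
    have hnot : ∀ y b, runWires (if v.testBit 0 then [] else [WireGate.not c])
        (writeNum (c + 1) w (u / 2) (Function.update y c b)) =
        writeNum (c + 1) w (u / 2) (Function.update y c (xor b (!v.testBit 0))) := by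
      intro y b
      split_ifs with h
      · simp [h]
      · simp only [runWires_cons, runWires_nil, WireGate.apply]
        rw [← writeNum_update hw1, hrd _ _ _ hw1]
        simp [h]
    have htof : ∀ y, runWires [WireGate.toffoli φ c a] (writeNum (c + 1) w (u / 2) y) =
        writeNum (c + 1) w (u / 2) (Function.update y a (xor (y a) (y φ && y c))) := by
      intro y
      simp only [runWires_cons, runWires_nil, WireGate.apply]
      rw [← writeNum_update hw2, hrd _ _ _ hw1, hrd _ _ _ hw2, hrd _ _ _ hw3]
    rw [checkNum, runWires_append, runWires_append, runWires_append, runWires_append,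
      writeNum_succ, hnot, htof,
      ih a (c + 1) (a + 1) _ _ _ (by omega) (by omega) (by omega) (by omega) (by omega) (by
        intro i hi hi'
        rw [Function.update_of_ne (by omega), Function.update_of_ne (by omega)]
        exact hx i (by omega) (by omega)), htof, writeNum_succ]
    have hval : (decide (u % 2 ^ (w + 1) = v % 2 ^ (w + 1))) =
        (xor (u.testBit 0) (!v.testBit 0) && decide (u / 2 % 2 ^ w = v / 2 % 2 ^ w)) := by
      have e : ∀ u : ℕ, u % 2 ^ (w + 1) = u % 2 + 2 * (u / 2 % 2 ^ w) := by
        intro u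
        rw [pow_succ', Nat.mod_mul]
      rw [e, e, Nat.testBit_zero, Nat.testBit_zero]
      by_cases h : u / 2 % 2 ^ w = v / 2 % 2 ^ w
      · rcases Nat.mod_two_eq_zero_or_one u with h1 | h1 <;>
          rcases Nat.mod_two_eq_zero_or_one v with h2 | h2 <;> simp [h, h1, h2]
      · simp only [h, decide_false, Bool.and_false, decide_eq_false_iff_not]
        omega
    -- Brings the state into the form of an update at `c`, as `hnot` requires.
    have hfin : ∀ y : ℕ → Bool, y = Function.update (Function.update y c (y c)) c (y c) := by
      intro y; simp
    rw [hfin (Function.update _ a _), Function.update_idem, hnot]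
    congr 1
    rw [hval]
    funext i
    simp only [Function.update_apply]
    by_cases hic : i = c
    · subst hic; simp [hca, htc.symm]
    · by_cases hia : i = a
      · subst hia; simp [hic, hxa, hta.symm, hφc, hφa, hca, htc.symm, htφ.symm]
      · by_cases hit : i = t
        · subst hit; simp [htc, hta, hφc, hca.symm, hxa, Bool.and_assoc]
        · simp [hic, hia, hit]


/-! ### Predicates computed by nested counting -/

open Classical in
/-- `HasDepth w D d P`: the predicate `P` depends only on the wires in `D`, and whenever `t` is a
wire outside `D` and all wires from `N` on are free, there is a circuit with at most
`2 ^ (8 * w * d)` gates which flips the wire `t` if `P` holds, using the `d * (2 * w + 1)` wires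
from `N` on as ancillas.  A predicate that compares a number less than `2 ^ w` of predicates of
depth `d` that hold with a constant has depth `d + 1`. -/
def HasDepth (w : ℕ) (D : Set ℕ) (d : ℕ) (P : (ℕ → Bool) → Prop) : Prop :=
  DependsOn P D ∧ ∀ t N, t ∉ D → t < N → (∀ i ∈ D, i < N) → ∃ c : List WireGate,
    c.length ≤ 2 ^ (8 * w * d) ∧ (∀ g ∈ c, g.Ok (N + d * (2 * w + 1))) ∧
    ∀ x : ℕ → Bool, (∀ i, N ≤ i → i < N + d * (2 * w + 1) → x i = false) →
      runWires c x = Function.update x t (xor (x t) (decide (P x)))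

namespace HasDepth

variable {w d : ℕ} {D : Set ℕ}

theorem mono {d' : ℕ} {P : (ℕ → Bool) → Prop} (h : HasDepth w D d P) (hd : d ≤ d') :
    HasDepth w D d' P := by
  refine ⟨h.1, fun t N htD htN hD => ?_⟩
  obtain ⟨c, h1, h2, h3⟩ := h.2 t N htD htN hD
  have hle : N + d * (2 * w + 1) ≤ N + d' * (2 * w + 1) := by gcongr
  refine ⟨c, h1.trans (Nat.pow_le_pow_right (by norm_num) (by gcongr)),
    fun g hg => (h2 g hg).mono hle, fun x hx => h3 x fun i hi hi' => hx i hi (by omega)⟩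

theorem congr {P Q : (ℕ → Bool) → Prop} (h : HasDepth w D d P) (hPQ : ∀ x, P x ↔ Q x) :
    HasDepth w D d Q := by
  rwa [← funext fun x => propext (hPQ x)]

theorem var {i : ℕ} (hi : i ∈ D) : HasDepth w D 0 (fun x => x i = true) := by
  refine ⟨fun _ _ hxy => by simp only [hxy i hi], fun t N htD htN hD => ?_⟩
  refine ⟨[.cnot i t], by simp, ?_, fun x _ => by simp [WireGate.apply]⟩
  have := hD i hi
  simp only [List.mem_singleton, forall_eq, WireGate.Ok]
  refine ⟨by omega, by omega, fun h => htD (h ▸ hi)⟩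

theorem const_false : HasDepth w D 0 (fun _ => False) :=
  ⟨fun _ _ _ => rfl, fun _ _ _ _ _ => ⟨[], by simp, by simp, fun x _ => by simp⟩⟩

open Classical in
/-- Counting the predicates of a list that hold. -/
theorem exists_counter (L : List ((ℕ → Bool) → Prop)) (hL : ∀ P ∈ L, HasDepth w D d P) (N : ℕ)
    (hD : ∀ i ∈ D, i < N) : ∃ c : List WireGate,
      c.length ≤ L.length * (2 * 2 ^ (8 * w * d) + 3 * w) ∧
      (∀ g ∈ c, g.Ok (N + (d + 1) * (2 * w + 1))) ∧
      ∀ (x : ℕ → Bool) (v : ℕ),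
        (∀ i, N ≤ i → i < N + (d + 1) * (2 * w + 1) → x i = false) →
        runWires c (writeNum (N + 1) w v x) =
          writeNum (N + 1) w (v + L.countP fun P => decide (P x)) x := by
  induction L with
  | nil => exact ⟨[], by simp, by simp, fun x v _ => by simp⟩
  | cons P L ih =>
    simp only [List.mem_cons, forall_eq_or_imp] at hL
    obtain ⟨c, h1, h2, h3⟩ := ih hL.2
    -- Layout of a layer: `N` is the flag, then come `w` counter wires, `w` carry wires, and the
    -- workspace of the subpredicates.
    have hsplit : N + (d + 1) * (2 * w + 1) = N + 1 + 2 * w + d * (2 * w + 1) := by ring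
    rw [hsplit] at h2 h3 ⊢
    obtain ⟨b, g1, g2, g3⟩ := hL.1.2 N (N + 1 + 2 * w) (fun h => (hD N h).false) (by omega)
      (fun i hi => by have := hD i hi; omega)
    have hnum : ∀ (x : ℕ → Bool) v, P (writeNum (N + 1) w v x) = P x := fun x v =>
      hL.1.1 fun i hi => writeNum_of_lt (by have := hD i hi; omega)
    have hupd : ∀ (x : ℕ → Bool) e, P (Function.update x N e) = P x := fun x e =>
      hL.1.1 fun i hi => Function.update_of_ne (by have := hD i hi; omega) _ _
    refine ⟨b ++ increment N (N + 1) (N + 1 + w) w ++ b ++ c, ?_, ?_, fun x v hx => ?_⟩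
    · simp only [List.length_append, length_increment, List.length_cons]
      nlinarith
    · intro g hg
      simp only [List.mem_append] at hg
      rcases hg with ((hg | hg) | hg) | hg
      · exact g2 g hg
      · exact increment_ok (by omega) (by omega) (by omega) g hg
      · exact g2 g hg
      · exact h2 g hg
    · have hflip : ∀ v e, runWires b (writeNum (N + 1) w v (Function.update x N e)) =
          writeNum (N + 1) w v (Function.update x N (xor e (decide (P x)))) := by
        intro v e
        rw [g3 _ (fun i hi hi' => by
          rw [writeNum_of_le (by omega), Function.update_of_ne (by omega)]
          exact hx i (by omega) (by omega)), hnum, hupd, writeNum_of_lt (by omega),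
          ← writeNum_update (Or.inl (by omega))]
        simp
      have hxN : Function.update x N false = x := by
        rw [← hx N le_rfl (by omega), Function.update_eq_self]
      rw [runWires_append, runWires_append, runWires_append]
      conv_lhs => rw [← hxN]
      rw [hflip, run_increment w _ _ _ _ _ (Or.inl (by omega)) (by omega) (by omega)
        (fun i hi hi' => by
          rw [Function.update_of_ne (by omega)]
          exact hx i (by omega) (by omega)), hflip]
      simp only [Bool.false_bne, Function.update_self, bne_self_eq_false]
      rw [hxN, h3 x _ hx, List.countP_cons, add_assoc]
      congr 1
      by_cases hP : P x <;> simp [hP]; omega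

open Classical in
-- Count, compare, then run the counting backwards. The bound on the length makes comparison modulo
-- `2 ^ w` exact; a constant outside the range of the counter is never attained.
theorem countP_eq (hw : 0 < w) (L : List ((ℕ → Bool) → Prop)) (hL : ∀ P ∈ L, HasDepth w D d P)
    (hlen : L.length < 2 ^ w) (k : ℕ) :
    HasDepth w D (d + 1) (fun x => (L.countP fun P => decide (P x)) = k) := by
  by_cases hk : 2 ^ w ≤ k
  · refine (const_false.mono (Nat.zero_le _)).congr fun x => ?_
    have := L.countP_le_length (p := fun P => decide (P x))
    simp only [false_iff]
    omega
  push Not at hk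
  have hdep : ∀ x y : ℕ → Bool, (∀ i ∈ D, x i = y i) →
      (L.countP fun P => decide (P x)) = L.countP fun P => decide (P y) := by
    intro x y hxy
    refine List.countP_congr fun P hP => ?_
    simp only [decide_eq_true_eq, (hL P hP).1 hxy]
  refine ⟨fun x y hxy => congrArg (· = k) (hdep x y hxy), fun t N htD htN hD => ?_⟩
  obtain ⟨c, h1, h2, h3⟩ := exists_counter L hL N hD
  have hsplit : N + (d + 1) * (2 * w + 1) = N + 1 + 2 * w + d * (2 * w + 1) := by ring
  -- The flag wire `N` is clean after the counting and is switched on to act as the control of the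
  -- comparison.
  refine ⟨c ++ [.not N] ++ checkNum t N (N + 1) (N + 1 + w) k w ++ [.not N] ++ c.reverse,
    ?_, ?_, fun x hx => ?_⟩
  · have hlen' := length_checkNum_le t N (N + 1) (N + 1 + w) k w
    have hw2 : w < 2 ^ w := Nat.lt_two_pow_self
    -- With `M = 2 ^ w ≥ 2` and `G` the size bound for a subpredicate, the length is at most `2 * M
    -- * (2 * G + 3 * M) + 4 * w + 3`. The exponent `8` is chosen so that `M ^ 8 * G` covers this.
    have hpow : 2 ^ (8 * w * (d + 1)) = (2 ^ w) ^ 8 * 2 ^ (8 * w * d) := by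
      rw [← pow_mul, ← pow_add]; congr 1; ring
    have hG : 1 ≤ 2 ^ (8 * w * d) := Nat.one_le_two_pow
    have hM : 2 ≤ 2 ^ w := by
      calc 2 = 2 ^ 1 := rfl
        _ ≤ 2 ^ w := Nat.pow_le_pow_right (by norm_num) hw
    rw [hpow]
    generalize 2 ^ (8 * w * d) = G at *
    generalize 2 ^ w = M at *
    simp only [List.length_append, List.length_reverse, List.length_singleton]
    have e1 : L.length * (2 * G + 3 * w) ≤ M * (2 * G + 3 * M) := by gcongr
    have e2 : M * (2 * G + 3 * M) ≤ M * M * (4 * G) := by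
      have : 2 * G + 3 * M ≤ M * (4 * G) := by nlinarith
      calc M * (2 * G + 3 * M) ≤ M * (M * (4 * G)) := by gcongr
        _ = M * M * (4 * G) := by ring
    have e3 : M * M * 64 ≤ M ^ 8 := by
      calc M * M * 64 = M * M * 2 ^ 6 := by norm_num
        _ ≤ M * M * M ^ 6 := by gcongr
        _ = M ^ 8 := by ring
    have e4 : M * M * 64 * G ≤ M ^ 8 * G := by gcongr
    nlinarith
  · intro g hg
    simp only [List.mem_append, List.mem_singleton, List.mem_reverse] at hg
    rcases hg with (((hg | rfl) | hg) | rfl) | hg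
    · exact h2 g hg
    · simp only [WireGate.Ok]; omega
    · exact checkNum_ok w t N (N + 1) (N + 1 + w) k (by omega) (by omega) (by omega) (by omega)
        (by omega) (by omega) g hg
    · simp only [WireGate.Ok]; omega
    · exact h2 g hg
  · have hclean : ∀ b, ∀ i, N + 1 ≤ i → i < N + 1 + w → Function.update x t b i = false := by
      intro b i hi hi'
      rw [Function.update_of_ne (by omega)]
      exact hx i (by omega) (by omega)
    set K := L.countP fun P => decide (P x) with hK
    have hnot : ∀ v (y : ℕ → Bool), runWires [.not N] (writeNum (N + 1) w v y) =
        writeNum (N + 1) w v (Function.update y N (!y N)) := by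
      intro v y
      rw [writeNum_update (Or.inl (by omega))]
      simp only [runWires_cons, runWires_nil, WireGate.apply]
      rw [writeNum_of_lt (by omega)]
    have hrun : ∀ b, runWires c (Function.update x t b) =
        writeNum (N + 1) w K (Function.update x t b) := by
      intro b
      have := h3 (Function.update x t b) 0 (by
        intro i hi hi'
        rw [Function.update_of_ne (by omega)]
        exact hx i (by omega) (by omega))
      rw [writeNum_zero_of_clean (hclean b), zero_add, hdep (Function.update x t b) x] at this
      · exact this
      · intro i hi
        exact Function.update_of_ne (fun h : i = t => htD (h ▸ hi)) _ _
    have hx0 : x = Function.update x t (x t) := by simp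
    have hKlt : K < 2 ^ w := L.countP_le_length.trans_lt hlen
    rw [runWires_append, runWires_append, runWires_append, runWires_append]
    conv_lhs => rw [hx0]
    rw [hrun, hnot, run_checkNum w _ _ _ _ _ _ _ (by omega) (by omega) (by omega) (by omega)
      (by omega) (by
        intro i hi hi'
        rw [Function.update_of_ne (by omega), Function.update_of_ne (by omega)]
        exact hx i (by omega) (by omega)), hnot, Nat.mod_eq_of_lt hKlt, Nat.mod_eq_of_lt hk]
    have hfin : ∀ b, Function.update (Function.update (Function.update (Function.update x t (x t))
        N true) t b) N false = Function.update x t b := by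
      intro b
      have hxN := hx N le_rfl (by omega)
      funext i
      simp only [Function.update_apply]
      by_cases h1 : i = N
      · subst h1
        simp only [if_true, hxN]
        rw [if_neg (by omega)]
      · simp only [h1, if_false]
        split_ifs <;> rfl
    have hxN : Function.update x t (x t) N = false := by
      rw [← hx0]; exact hx N le_rfl (by omega)
    have htN' : t ≠ N := by omega
    simp only [hxN, Bool.not_false, Function.update_self, Bool.true_and,
      Function.update_of_ne htN', Function.update_of_ne htN'.symm, Bool.not_true]
    rw [hfin, ← hrun, runWires_reverse h2, hK]
    congr!

open Classical in
/-- Comparing a weighted count with a constant. -/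
theorem sum_eq {ι : Type*} (hw : 0 < w) (s : Finset ι) (wt : ι → ℕ)
    {P : ι → (ℕ → Bool) → Prop} (hP : ∀ i ∈ s, HasDepth w D d (P i))
    (hs : ∑ i ∈ s, wt i < 2 ^ w) (k : ℕ) :
    HasDepth w D (d + 1) (fun x => (∑ i ∈ s, if P i x then wt i else 0) = k) := by
  -- A weight is realised by repeating the predicate, so it is the total weight that must stay below
  -- `2 ^ w`.
  have h := countP_eq hw (s.toList.flatMap fun i => List.replicate (wt i) (P i)) (by
      intro Q hQ
      simp only [List.mem_flatMap, Finset.mem_toList] at hQ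
      obtain ⟨i, hi, hQ⟩ := hQ
      rw [List.eq_of_mem_replicate hQ]
      exact hP i hi) (by
      simpa [List.length_flatMap, Finset.sum_map_toList] using hs) k
  refine h.congr fun x => ?_
  rw [List.countP_flatMap, ← Finset.sum_map_toList]
  have : (List.countP (fun P => decide (P x)) ∘ fun i => List.replicate (wt i) (P i)) =
      fun i => if P i x then wt i else 0 := by
    funext i
    simp [List.countP_replicate]
  rw [this]

open Classical in
theorem card_eq {ι : Type*} (hw : 0 < w) (s : Finset ι)
    {P : ι → (ℕ → Bool) → Prop} (hP : ∀ i ∈ s, HasDepth w D d (P i))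
    (hs : s.card < 2 ^ w) (k : ℕ) :
    HasDepth w D (d + 1) (fun x => (s.filter fun i => P i x).card = k) := by
  refine (sum_eq hw s (fun _ => 1) hP (by simpa using hs) k).congr fun x => ?_
  rw [Finset.card_filter]

theorem forall_mem {ι : Type*} (hw : 0 < w) (s : Finset ι)
    {P : ι → (ℕ → Bool) → Prop} (hP : ∀ i ∈ s, HasDepth w D d (P i))
    (hs : s.card < 2 ^ w) : HasDepth w D (d + 1) (fun x => ∀ i ∈ s, P i x) := by
  classical
  refine (card_eq hw s hP hs s.card).congr fun x => ?_
  rw [Finset.card_filter_eq_iff]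

theorem not (hw : 0 < w) {P : (ℕ → Bool) → Prop} (hP : HasDepth w D d P) :
    HasDepth w D (d + 1) (fun x => ¬P x) := by
  classical
  refine (card_eq hw {()} (P := fun _ => P) (fun _ _ => hP) ?_ 0).congr fun x => ?_
  · simpa using hw.ne'
  · simp [Finset.filter_singleton]

theorem exists_mem {ι : Type*} (hw : 0 < w) (s : Finset ι)
    {P : ι → (ℕ → Bool) → Prop} (hP : ∀ i ∈ s, HasDepth w D d (P i))
    (hs : s.card < 2 ^ w) : HasDepth w D (d + 2) (fun x => ∃ i ∈ s, P i x) := by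
  classical
  refine ((card_eq hw s hP hs 0).not hw).congr fun x => ?_
  rw [Finset.card_eq_zero, Finset.filter_eq_empty_iff]
  push Not
  rfl

theorem const (hw : 0 < w) (p : Prop) : HasDepth w D (d + 1) (fun _ => p) := by
  by_cases hp : p
  · exact ((const_false.not hw).mono (by omega)).congr fun x => by simp [hp]
  · exact (const_false.mono (by omega)).congr fun x => by simp [hp]

/-- A conjunction with a condition that does not depend on the wires. -/
theorem const_and {p : Prop} {P : (ℕ → Bool) → Prop} (hP : p → HasDepth w D d P) :
    HasDepth w D d (fun x => p ∧ P x) := by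
  by_cases hp : p
  · exact (hP hp).congr fun x => by simp [hp]
  · exact (const_false.mono (by omega)).congr fun x => by simp [hp]

theorem and (hw : 2 ≤ w) {P Q : (ℕ → Bool) → Prop} (hP : HasDepth w D d P)
    (hQ : HasDepth w D d Q) : HasDepth w D (d + 1) (fun x => P x ∧ Q x) := by
  refine (forall_mem (by omega) Finset.univ (P := fun b : Bool => if b then P else Q)
    (fun b _ => by cases b <;> simpa) ?_).congr fun x => ?_
  · have : 2 ^ 2 ≤ 2 ^ w := Nat.pow_le_pow_right (by norm_num) hw
    simp
    omega
  · simp [and_comm]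

end HasDepth


/-! ### The encoding of a set, in terms of consecutive elements -/

/-- The largest element of `S` below `a`, or `0` if there is none. -/
def predIn (S : Finset ℕ) (a : ℕ) : ℕ := (S.filter (· < a)).sup id

/-- `a` is an element of `S` and `b` is the element before it, or `0` if `a` is the first. -/
def Consecutive (S : Finset ℕ) (b a : ℕ) : Prop :=
  (b = 0 ∨ b ∈ S) ∧ b < a ∧ a ∈ S ∧ ∀ c ∈ Finset.Ioo b a, c ∉ S

/-- Replaces a supremum by a bounded condition on membership, which has small depth. The value `0`
serves as predecessor of the smallest element. -/
theorem consecutive_iff {S : Finset ℕ} {b a : ℕ} (ha : 0 < a) :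
    Consecutive S b a ↔ a ∈ S ∧ b = predIn S a := by
  constructor
  · rintro ⟨h1, h2, h3, h4⟩
    refine ⟨h3, le_antisymm ?_ (Finset.sup_le fun c hc => ?_)⟩
    · rcases h1 with rfl | h1
      · exact Nat.zero_le _
      · exact Finset.le_sup (f := id) (Finset.mem_filter.2 ⟨h1, h2⟩)
    · rw [Finset.mem_filter] at hc
      by_contra h
      exact h4 c (Finset.mem_Ioo.2 ⟨not_le.1 h, hc.2⟩) hc.1
  · rintro ⟨h1, rfl⟩
    refine ⟨?_, ?_, h1, fun c hc hcS => ?_⟩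
    · rcases (S.filter (· < a)).eq_empty_or_nonempty with h | h
      · left; simp [predIn, h]
      · right
        obtain ⟨c, hc, hc'⟩ := Finset.exists_mem_eq_sup _ h id
        rw [predIn, hc']
        exact (Finset.mem_filter.1 hc).1
    · exact (Finset.sup_lt_iff (by simpa using ha)).2 fun c hc => (Finset.mem_filter.1 hc).2
    · rw [Finset.mem_Ioo] at hc
      exact hc.1.not_ge (Finset.le_sup (f := id) (Finset.mem_filter.2 ⟨hcS, hc.2⟩))

theorem sort_insert_max {S : Finset ℕ} {m : ℕ} (h : ∀ y ∈ S, y < m) :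
    (insert m S).sort (· ≤ ·) = S.sort (· ≤ ·) ++ [m] := by
  have hm : m ∉ S := fun hm => (h m hm).false
  refine List.Perm.eq_of_pairwise' (r := (· ≤ ·)) ?_ ?_ ?_
  · exact Finset.pairwise_sort _ _
  · rw [List.pairwise_append]
    refine ⟨Finset.pairwise_sort _ _, by simp, fun a ha b hb => ?_⟩
    rw [List.mem_singleton] at hb
    subst hb
    exact (h a (by simpa using ha)).le
  · rw [List.perm_ext_iff_of_nodup (Finset.sort_nodup _ _)]
    · simp [or_comm]
    · rw [List.nodup_append]
      refine ⟨Finset.sort_nodup _ _, by simp, fun a ha b hb => ?_⟩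
      rw [List.mem_singleton] at hb
      subst hb
      exact (h a (by simpa using ha)).ne

theorem shifts_append_singleton (p m : ℕ) (l : List ℕ) :
    shifts p (l ++ [m]) = shifts p l ++ [m - l.getLastD p] := by
  induction l generalizing p with
  | nil => rfl
  | cons y l ih =>
    rw [List.cons_append, shifts, ih, shifts, List.getLastD_cons]
    rfl

theorem getLastD_sort (S : Finset ℕ) : (S.sort (· ≤ ·)).getLastD 0 = S.sup id := by
  induction S using Finset.induction_on_max with
  | empty => simp
  | insert m S h _ =>
    rw [sort_insert_max h, Finset.sup_insert]
    have : S.sup id ≤ m := Finset.sup_le fun y hy => (h y hy).le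
    simpa using this

theorem encSet_insert_max {S : Finset ℕ} {m : ℕ} (h : ∀ y ∈ S, y < m) :
    encSet (insert m S) = encSet S ++ encNat (m - S.sup id) := by
  rw [encSet, sort_insert_max h, shifts_append_singleton, List.flatMap_append, getLastD_sort]
  simp [encSet]

theorem filter_le_succ (S : Finset ℕ) (a : ℕ) : S.filter (· ≤ a + 1) =
    if a + 1 ∈ S then insert (a + 1) (S.filter (· ≤ a)) else S.filter (· ≤ a) := by
  ext y
  split_ifs with h <;> simp only [Finset.mem_insert, Finset.mem_filter]
  · constructor
    · rintro ⟨h1, h2⟩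
      rcases Nat.le_succ_iff.1 h2 with h3 | h3
      · exact Or.inr ⟨h1, h3⟩
      · exact Or.inl h3
    · rintro (rfl | h1)
      · exact ⟨h, le_rfl⟩
      · exact ⟨h1.1, by omega⟩
  · constructor
    · rintro ⟨h1, h2⟩
      refine ⟨h1, ?_⟩
      rcases Nat.le_succ_iff.1 h2 with h3 | rfl
      · exact h3
      · exact absurd h1 h
    · exact fun h1 => ⟨h1.1, by omega⟩

/-- Raising the threshold past an element appends exactly one codeword; the formulas for offsets and
symbols follow by induction on the threshold. -/
theorem encSet_filter_succ (S : Finset ℕ) (a : ℕ) : encSet (S.filter (· ≤ a + 1)) =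
    encSet (S.filter (· ≤ a)) ++
      if a + 1 ∈ S then encNat (a + 1 - predIn S (a + 1)) else [] := by
  rw [filter_le_succ]
  split_ifs with h
  · rw [encSet_insert_max fun y hy => Nat.lt_succ_of_le (Finset.mem_filter.1 hy).2]
    simp only [predIn, Nat.lt_succ_iff]
  · simp

theorem encSet_filter_zero {S : Finset ℕ} (hS : 0 ∉ S) : encSet (S.filter (· ≤ 0)) = [] := by
  have : S.filter (· ≤ 0) = ∅ := by
    ext y
    simp only [Finset.mem_filter, nonpos_iff_eq_zero, Finset.notMem_empty, iff_false]
    rintro ⟨h1, rfl⟩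
    exact hS h1
  rw [this]
  simp [encSet, shifts]

theorem length_encSet_filter {S : Finset ℕ} (hS : 0 ∉ S) (a : ℕ) :
    (encSet (S.filter (· ≤ a))).length =
      ∑ b ∈ Finset.range a,
        if b + 1 ∈ S then (encNat (b + 1 - predIn S (b + 1))).length else 0 := by
  induction a with
  | zero => rw [encSet_filter_zero hS]; simp
  | succ a ih =>
    rw [encSet_filter_succ, List.length_append, ih, Finset.sum_range_succ]
    split_ifs <;> simp

/-- Codewords fill consecutive intervals, so a symbol is located by an element, its predecessor and
the offset of its codeword, all bounded quantities. -/
theorem getElem?_encSet_filter {S : Finset ℕ} (hS : 0 ∉ S) (U p : ℕ) (t : Fin 3) :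
    (encSet (S.filter (· ≤ U)))[p]? = some t ↔ ∃ a < U, a + 1 ∈ S ∧
      (encSet (S.filter (· ≤ a))).length ≤ p ∧
      (encNat (a + 1 - predIn S (a + 1)))[p - (encSet (S.filter (· ≤ a))).length]? = some t := by
  induction U with
  | zero => rw [encSet_filter_zero hS]; simp
  | succ U ih =>
    simp only [Nat.lt_succ_iff_lt_or_eq, or_and_right, exists_or, exists_eq_left]
    rw [← ih, encSet_filter_succ]
    by_cases h : p < (encSet (S.filter (· ≤ U))).length
    · rw [List.getElem?_append_left h]
      constructor
      · exact Or.inl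
      · rintro (h' | h')
        · exact h'
        · omega
    · rw [List.getElem?_append_right (not_lt.1 h),
        List.getElem?_eq_none (l := encSet (S.filter (· ≤ U))) (not_lt.1 h)]
      split_ifs with hU
      · simp [hU, not_lt.1 h]
      · simp [hU]

/-! ### Decoding -/

theorem encNat_injective : Function.Injective encNat := by
  intro a b h
  unfold encNat at h
  rw [List.append_cancel_right_eq] at h
  have h' := List.map_injective_iff.2 (by
    intro u v huv
    cases u <;> cases v <;> simp_all) h
  have h2 := List.reverse_injective h'
  have key : ∀ c : ℕ, (Nat.bits c).foldr (fun b n => Nat.bit b n) 0 = c := by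
    intro c
    induction c using Nat.binaryRec' with
    | zero => simp
    | bit b n hb ih => rw [Nat.bits_append_bit n b hb]; simp [ih]
  rw [← key a, h2, key b]

theorem length_encNat (d : ℕ) : (encNat d).length = d.size + 1 := by
  simp [encNat, Nat.size_eq_bits_len]

theorem getElem?_encNat_eq_two {d j : ℕ} : (encNat d)[j]? = some 2 ↔ j + 1 = (encNat d).length := by
  rw [encNat, List.length_append, List.length_singleton, Nat.add_right_cancel_iff]
  rcases lt_trichotomy j (List.map (fun b => if b = true then (1 : Fin 3) else 0)
    (Nat.bits d).reverse).length with h | h | h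
  · rw [List.getElem?_append_left h]
    simp only [h.ne, iff_false]
    rw [List.getElem?_eq_getElem h, Option.some.injEq, List.getElem_map]
    split_ifs <;> decide
  · rw [h, List.getElem?_append_right le_rfl]
    simp
  · rw [List.getElem?_eq_none (by simp at h ⊢; omega)]
    simpa using h.ne'

/-- The separator occurs only as the last symbol, so its first occurrence fixes the length of the
codeword: the code is prefix-free. -/
theorem encNat_prefix_iff {d d₀ : ℕ} {l : List (Fin 3)} :
    encNat d <+: encNat d₀ ++ l ↔ d = d₀ := by
  constructor
  · intro h
    have key : ∀ {j}, j < (encNat d).length → (encNat d₀ ++ l)[j]? = (encNat d)[j]? := by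
      intro j hj
      obtain ⟨r, hr⟩ := h
      rw [← hr, List.getElem?_append_left hj]
    have h1 : (encNat d).length ≠ 0 := by simp [length_encNat]
    have h2 : (encNat d₀).length ≠ 0 := by simp [length_encNat]
    have hlen : (encNat d).length = (encNat d₀).length := by
      rcases lt_trichotomy (encNat d).length (encNat d₀).length with hlt | heq | hgt
      · have := key (j := (encNat d).length - 1) (by omega)
        rw [List.getElem?_append_left (by omega),
          (getElem?_encNat_eq_two (d := d)).2 (by omega), getElem?_encNat_eq_two] at this
        omega
      · exact heq
      · have := key (j := (encNat d₀).length - 1) (by omega)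
        rw [List.getElem?_append_left (by omega), getElem?_encNat_eq_two.2 (by omega), eq_comm,
          getElem?_encNat_eq_two] at this
        omega
    refine encNat_injective ?_
    have := List.prefix_of_prefix_length_le h (List.prefix_append _ l) hlen.le
    exact this.eq_of_length hlen
  · rintro rfl
    exact List.prefix_append _ _

/-- The position `p` is `0` or follows a separation character. -/
def IsStart (l : List (Fin 3)) (p : ℕ) : Prop := p = 0 ∨ l[p - 1]? = some 2

open Classical in
/-- The sum of the numbers up to `U` encoded in `l` that end at position `q` or before it. -/
noncomputable def decodeSum (U : ℕ) (l : List (Fin 3)) (q : ℕ) : ℕ :=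
  ∑ p ∈ Finset.range l.length, ∑ d ∈ Finset.Icc 1 U,
    if p + (encNat d).length ≤ q + 1 ∧ IsStart l p ∧ encNat d <+: l.drop p then d else 0

open Classical in
/-- The set of positive integers up to `U` that is encoded in `l`. -/
noncomputable def decodeSet (U : ℕ) (l : List (Fin 3)) : Finset ℕ :=
  (Finset.Icc 1 U).filter fun a =>
    ∃ q ∈ Finset.range l.length, l[q]? = some 2 ∧ decodeSum U l q = a

/-- Within the first codeword only position `0` is a start, and prefix-freeness leaves `d` as the
only number read there. Its final separator makes the next position a start, so the remaining starts
are those of `l`, shifted. -/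
theorem decodeSum_encNat_append {U d : ℕ} (hd : 1 ≤ d) (hdU : d ≤ U) (l : List (Fin 3)) {q : ℕ}
    (hq : (encNat d).length ≤ q + 1) :
    decodeSum U (encNat d ++ l) q = d +
      ∑ p ∈ Finset.range l.length, ∑ e ∈ Finset.Icc 1 U, open Classical in
        if (encNat d).length + p + (encNat e).length ≤ q + 1 ∧ IsStart l p ∧
          encNat e <+: l.drop p then e else 0 := by
  classical
  have hpos : 0 < (encNat d).length := by simp [length_encNat]
  rw [decodeSum, List.length_append, Finset.sum_range_add]
  congr 1
  · rw [Finset.sum_eq_single_of_mem 0 (Finset.mem_range.2 hpos)]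
    · rw [Finset.sum_eq_single_of_mem d (Finset.mem_Icc.2 ⟨hd, hdU⟩)]
      · rw [if_pos]
        exact ⟨by omega, Or.inl rfl, by simp⟩
      · intro e _ he
        rw [if_neg]
        rintro ⟨_, _, h⟩
        exact he (encNat_prefix_iff.1 (by simpa using h))
    · intro p hp hp0
      rw [Finset.mem_range] at hp
      refine Finset.sum_eq_zero fun e _ => if_neg ?_
      rintro ⟨_, h | h, _⟩
      · exact hp0 h
      · rw [List.getElem?_append_left (by omega), getElem?_encNat_eq_two] at h
        omega
  · refine Finset.sum_congr rfl fun p _ => Finset.sum_congr rfl fun e _ => ?_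
    have hs : IsStart (encNat d ++ l) ((encNat d).length + p) ↔ IsStart l p := by
      unfold IsStart
      rcases Nat.eq_zero_or_pos p with rfl | hp
      · simp only [add_zero, true_or, iff_true]
        right
        rw [List.getElem?_append_left (by omega), getElem?_encNat_eq_two]
        omega
      · rw [List.getElem?_append_right (by omega)]
        have : (encNat d).length + p - 1 - (encNat d).length = p - 1 := by omega
        rw [this]
        simp only [hp.ne', false_or, or_iff_right_iff_imp]
        omega
    rw [hs, List.drop_append, List.drop_eq_nil_of_le (by omega)]
    simp

/-- The shifts telescope: summed up to a separator they give the element itself, with `p₀` as the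
part already summed. The zero padding contains no separator and yields nothing. -/
theorem decode_shifts {U : ℕ} (z p₀ a : ℕ) (ys : List ℕ) (hl : (p₀ :: ys).Pairwise (· < ·))
    (hU : ∀ y ∈ ys, y ≤ U) :
    (∃ q, ((shifts p₀ ys).flatMap encNat ++ List.replicate z 0)[q]? = some 2 ∧
      p₀ + decodeSum U ((shifts p₀ ys).flatMap encNat ++ List.replicate z 0) q = a) ↔
      a ∈ ys := by
  induction ys generalizing p₀ with
  | nil =>
    simp only [shifts, List.flatMap_nil, List.nil_append, List.not_mem_nil, iff_false]
    rintro ⟨q, h, -⟩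
    have := List.mem_of_getElem? h
    rw [List.mem_replicate] at this
    exact absurd this.2 (by decide)
  | cons y ys ih =>
    have h1 := List.pairwise_cons.1 hl
    have hpy : p₀ < y := h1.1 y (by simp)
    have hy : y ≤ U := hU y (by simp)
    have ih := ih y h1.2 fun z hz => hU z (by simp [hz])
    simp only [shifts, List.flatMap_cons, List.append_assoc]
    generalize (shifts y ys).flatMap encNat ++ List.replicate z 0 = l at ih
    have hpos : 0 < (encNat (y - p₀)).length := by simp [length_encNat]
    rw [List.mem_cons, ← ih]
    constructor
    · rintro ⟨q, h2, h3⟩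
      rcases lt_or_ge q (encNat (y - p₀)).length with hq | hq
      · left
        rw [List.getElem?_append_left hq, getElem?_encNat_eq_two] at h2
        rw [decodeSum_encNat_append (by omega) (by omega) l (by omega)] at h3
        rw [Finset.sum_eq_zero] at h3
        · omega
        · refine fun p _ => Finset.sum_eq_zero fun e _ => if_neg ?_
          rintro ⟨h4, _⟩
          rw [length_encNat e] at h4
          omega
      · right
        rw [List.getElem?_append_right hq] at h2
        refine ⟨_, h2, ?_⟩
        rw [decodeSum_encNat_append (by omega) (by omega) l (by omega), ← add_assoc,
          Nat.add_sub_cancel' hpy.le] at h3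
        rw [← h3, decodeSum]
        refine congrArg (y + ·) (Finset.sum_congr rfl fun p _ => Finset.sum_congr rfl fun e _ => ?_)
        exact @if_congr _ _ _ (_) (_) _ _ _ _ (and_congr (by omega) Iff.rfl) rfl rfl
    · rintro (rfl | ⟨q, h2, h3⟩)
      · refine ⟨(encNat (a - p₀)).length - 1, ?_, ?_⟩
        · rw [List.getElem?_append_left (by omega), getElem?_encNat_eq_two]
          omega
        · rw [decodeSum_encNat_append (by omega) (by omega) l (by omega), Finset.sum_eq_zero]
          · omega
          · refine fun p _ => Finset.sum_eq_zero fun e _ => if_neg ?_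
            rintro ⟨h4, _⟩
            rw [length_encNat e] at h4
            omega
      · refine ⟨(encNat (y - p₀)).length + q, ?_, ?_⟩
        · rw [List.getElem?_append_right (by omega), Nat.add_sub_cancel_left]
          exact h2
        · rw [decodeSum_encNat_append (by omega) (by omega) l (by omega), ← add_assoc,
            Nat.add_sub_cancel' hpy.le, ← h3, decodeSum]
          refine congrArg (y + ·)
            (Finset.sum_congr rfl fun p _ => Finset.sum_congr rfl fun e _ => ?_)
          exact @if_congr _ _ _ (_) (_) _ _ _ _ (and_congr (by omega) Iff.rfl) rfl rfl

theorem decodeSet_encSet {U : ℕ} {S : Finset ℕ} (hS : ∀ y ∈ S, 0 < y ∧ y ≤ U) (z : ℕ) :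
    decodeSet U (encSet S ++ List.replicate z 0) = S := by
  have h := decode_shifts (U := U) z 0 (ys := S.sort (· ≤ ·)) (hl := by
    refine List.pairwise_cons.2 ⟨fun y hy => (hS y (by simpa using hy)).1, ?_⟩
    exact (Finset.sortedLT_sort S).pairwise) (hU := fun y hy => (hS y (by simpa using hy)).2)
  ext a
  rw [decodeSet, Finset.mem_filter, Finset.mem_Icc]
  have h' := h a
  simp only [zero_add, Finset.mem_sort] at h'
  unfold encSet
  rw [← h']
  constructor
  · rintro ⟨-, q, -, hq⟩
    exact ⟨q, hq⟩
  · rintro ⟨q, hq⟩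
    refine ⟨hS a (h'.1 ⟨q, hq⟩), q, ?_, hq⟩
    rw [Finset.mem_range]
    exact (List.getElem?_eq_some_iff.1 hq.1).1


/-! ### Reading trits -/

/-- The trit `p` of the register that begins at the wire `b`. -/
def readTrit (b : ℕ) (x : ℕ → Bool) (p : ℕ) : Fin 3 :=
  if x (b + 2 * p + 1) then 2 else if x (b + 2 * p) then 1 else 0

/-- The content of the register of `T` trits that begins at the wire `b`. -/
def readTrits (b T : ℕ) (x : ℕ → Bool) : List (Fin 3) := (List.range T).map (readTrit b x)

@[simp] theorem length_readTrits (b T : ℕ) (x : ℕ → Bool) : (readTrits b T x).length = T := by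
  simp [readTrits]

theorem getElem?_readTrits {b T p : ℕ} {x : ℕ → Bool} {t : Fin 3} :
    (readTrits b T x)[p]? = some t ↔ p < T ∧ readTrit b x p = t := by
  simp [readTrits, List.getElem?_eq_some_iff]

/-- The wires of the register of `T` trits that begins at the wire `b`. -/
abbrev regWires (b T : ℕ) : Set ℕ := Set.Ico b (b + 2 * T)

theorem getD_flatMap_tritBits (l : List (Fin 3)) (p : ℕ) :
    (l.flatMap tritBits).getD (2 * p) false = decide (l[p]? = some 1) ∧
      (l.flatMap tritBits).getD (2 * p + 1) false = decide (l[p]? = some 2) := by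
  induction l generalizing p with
  | nil => simp
  | cons t l ih =>
    cases p with
    | zero => simp [tritBits]
    | succ p =>
      have := ih p
      rw [List.flatMap_cons]
      simpa [tritBits, Nat.mul_add] using this

/-- The register of `T` trits that begins at the wire `b` contains `l`. -/
def Holds (b T : ℕ) (l : List (Fin 3)) (x : ℕ → Bool) : Prop :=
  ∀ i < 2 * T, x (b + i) = (l.flatMap tritBits).getD i false

theorem Holds.readTrit_eq {b T : ℕ} {l : List (Fin 3)} {x : ℕ → Bool} (h : Holds b T l x)
    {p : ℕ} (hp : p < T) (hpl : p < l.length) : readTrit b x p = l[p] := by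
  have h1 := h (2 * p) (by omega)
  have h2 := h (2 * p + 1) (by omega)
  rw [(getD_flatMap_tritBits l p).1] at h1
  rw [(getD_flatMap_tritBits l p).2, ← add_assoc] at h2
  rw [readTrit, h1, h2, List.getElem?_eq_getElem hpl]
  generalize l[p] = t
  fin_cases t <;> decide

theorem Holds.readTrits_eq {b T : ℕ} {l : List (Fin 3)} {x : ℕ → Bool} (h : Holds b T l x)
    (hl : l.length = T) : readTrits b T x = l := by
  refine List.ext_getElem (by simp [hl]) fun p hp hpl => ?_
  simp only [readTrits, List.getElem_map, List.getElem_range]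
  exact h.readTrit_eq (by omega) hpl

/-! ### Depth of reading trits and decoding a set -/

namespace HasDepth

variable {w d : ℕ} {D : Set ℕ}

theorem readTrit_eq (hw : 2 ≤ w) {b T p : ℕ} (hD : regWires b T ⊆ D) (hp : p < T) (t : Fin 3) :
    HasDepth w D 2 (fun x => readTrit b x p = t) := by
  have h0 : HasDepth w D 0 (fun x => x (b + 2 * p) = true) :=
    var (hD ⟨by omega, by omega⟩)
  have h1 : HasDepth w D 0 (fun x => x (b + 2 * p + 1) = true) :=
    var (hD ⟨by omega, by omega⟩)
  have hw' : 0 < w := by omega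
  fin_cases t
  · refine ((h1.not hw').and hw (h0.not hw')).congr fun x => ?_
    unfold readTrit
    split_ifs with h h' <;> simp [*]
  · refine ((h1.not hw').and hw (h0.mono zero_le_one)).congr fun x => ?_
    unfold readTrit
    split_ifs with h h' <;> simp [*]
  · refine (h1.mono (Nat.zero_le 2)).congr fun x => ?_
    unfold readTrit
    split_ifs with h h' <;> simp [h]

theorem getElem?_readTrits_eq (hw : 2 ≤ w) {b T : ℕ} (hD : regWires b T ⊆ D) (p : ℕ)
    (t : Fin 3) : HasDepth w D 2 (fun x => (readTrits b T x)[p]? = some t) :=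
  (const_and fun hp : p < T => readTrit_eq hw hD hp t).congr fun _ => getElem?_readTrits.symm

/-- Depth `4` recognises a codeword at a start, the weighted count makes it `5`, the separator test
`6`, and the choice of `q` makes it `8`. The total weight is at most `T * U * U`. -/
theorem mem_decodeSet (hw : 2 ≤ w) {b T U : ℕ} (hD : regWires b T ⊆ D)
    (hcap : (U + T + 2) ^ 4 < 2 ^ w) (a : ℕ) :
    HasDepth w D 8 (fun x => a ∈ decodeSet U (readTrits b T x)) := by
  classical
  have hw' : 0 < w := by omega
  have hT : T < 2 ^ w := by
    refine lt_of_le_of_lt ?_ hcap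
    calc T ≤ U + T + 2 := by omega
      _ ≤ (U + T + 2) ^ 4 := Nat.le_self_pow (by norm_num) _
  have hstart : ∀ p, HasDepth w D 2 (fun x => IsStart (readTrits b T x) p) := by
    intro p
    by_cases hp : p = 0
    · exact (const hw' True).congr fun x => by simp [IsStart, hp]
    · exact (getElem?_readTrits_eq hw hD (p - 1) 2).congr fun x => by simp [IsStart, hp]
  have hprefix : ∀ p d, HasDepth w D 3 (fun x => encNat d <+: (readTrits b T x).drop p) := by
    intro p d
    refine (const_and (p := p + (encNat d).length ≤ T)
      (P := fun x => ∀ j ∈ Finset.range (encNat d).length,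
        (readTrits b T x)[p + j]? = some ((encNat d).getD j 0)) fun hp => ?_).congr fun x => ?_
    · exact forall_mem hw' _ (fun j _ => getElem?_readTrits_eq hw hD _ _)
        (by simp only [Finset.card_range]; omega)
    · rw [List.prefix_iff_getElem?]
      simp only [Finset.mem_range, List.getElem?_drop]
      constructor
      · rintro ⟨-, h⟩ j hj
        rw [h j hj, List.getD_eq_getElem _ _ hj]
      · intro h
        refine ⟨?_, fun j hj => by rw [h j hj, List.getD_eq_getElem _ _ hj]⟩
        have hpos : 0 < (encNat d).length := by simp [length_encNat]
        have := (List.getElem?_eq_some_iff.1 (h ((encNat d).length - 1) (by omega))).1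
        simp only [length_readTrits] at this
        omega
  have hsum : ∀ q, HasDepth w D 5 (fun x => decodeSum U (readTrits b T x) q = a) := by
    intro q
    refine (sum_eq hw' (Finset.range T ×ˢ Finset.Icc 1 U) (fun i => i.2) (fun i _ =>
      const_and (p := i.1 + (encNat i.2).length ≤ q + 1) fun _ =>
        ((hstart i.1).mono (by norm_num)).and hw (hprefix i.1 i.2)) ?_ a).congr fun x => ?_
    · calc ∑ i ∈ Finset.range T ×ˢ Finset.Icc 1 U, i.2
          ≤ ∑ _i ∈ Finset.range T ×ˢ Finset.Icc 1 U, U := by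
            refine Finset.sum_le_sum fun i hi => ?_
            simp only [Finset.mem_product, Finset.mem_Icc] at hi
            exact hi.2.2
        _ = T * U * U := by simp
        _ ≤ (U + T + 2) * (U + T + 2) * (U + T + 2) := by gcongr <;> omega
        _ ≤ (U + T + 2) ^ 4 := by
            rw [pow_succ, pow_succ, pow_two]
            exact Nat.le_mul_of_pos_right _ (by omega)
        _ < 2 ^ w := hcap
    · rw [Finset.sum_product, decodeSum, length_readTrits]
      congr!
  refine (const_and (p := a ∈ Finset.Icc 1 U) fun _ => exists_mem hw' (Finset.range T)
    (fun q _ => ((getElem?_readTrits_eq hw hD q 2).mono (by norm_num)).and hw (hsum q))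
    (by simpa using hT)).congr fun x => ?_
  rw [decodeSet, Finset.mem_filter, length_readTrits]

end HasDepth

open Classical in
/-- The union of the sets encoded in the registers of a list.  A register is given by its first
wire and its number of trits. -/
noncomputable def decodeRegs (U : ℕ) (regs : List (ℕ × ℕ)) (x : ℕ → Bool) : Finset ℕ :=
  regs.toFinset.biUnion fun g => decodeSet U (readTrits g.1 g.2 x)

theorem mem_decodeSet_bounds {U a : ℕ} {l : List (Fin 3)} (h : a ∈ decodeSet U l) :
    0 < a ∧ a ≤ U := by
  classical
  rw [decodeSet, Finset.mem_filter, Finset.mem_Icc] at h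
  exact h.1

theorem mem_decodeRegs_bounds {U a : ℕ} {regs : List (ℕ × ℕ)} {x : ℕ → Bool}
    (h : a ∈ decodeRegs U regs x) : 0 < a ∧ a ≤ U := by
  classical
  rw [decodeRegs, Finset.mem_biUnion] at h
  obtain ⟨g, -, h⟩ := h
  exact mem_decodeSet_bounds h

namespace HasDepth

variable {w d : ℕ} {D : Set ℕ}

theorem mem_decodeRegs (hw : 2 ≤ w) {T U : ℕ} {regs : List (ℕ × ℕ)}
    (hD : ∀ g ∈ regs, regWires g.1 g.2 ⊆ D) (hT : ∀ g ∈ regs, g.2 ≤ T)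
    (hcap : (U + T + 2) ^ 4 < 2 ^ w) (hlen : regs.length < 2 ^ w) (a : ℕ) :
    HasDepth w D 10 (fun x => a ∈ decodeRegs U regs x) := by
  classical
  refine (exists_mem (by omega) regs.toFinset
    (P := fun g x => a ∈ decodeSet U (readTrits g.1 g.2 x)) (fun g hg => ?_)
    (regs.toFinset_card_le.trans_lt hlen)).congr fun x => ?_
  · rw [List.mem_toFinset] at hg
    refine mem_decodeSet hw (hD g hg) (lt_of_le_of_lt ?_ hcap) a
    have := hT g hg
    gcongr
  · rw [decodeRegs, Finset.mem_biUnion]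

/-! ### Writing the encoding of a set -/

theorem consecutive (hw : 2 ≤ w) {S : (ℕ → Bool) → Finset ℕ}
    (hS : ∀ a, HasDepth w D d (fun x => a ∈ S x)) {b a : ℕ} (ha : a < 2 ^ w) :
    HasDepth w D (d + 4) (fun x => Consecutive (S x) b a) := by
  have hw' : 0 < w := by omega
  have h1 : HasDepth w D (d + 3) (fun x => b = 0 ∨ b ∈ S x) := by
    by_cases hb : b = 0
    · exact ((const hw' True).mono (Nat.le_add_left _ _)).congr fun x => by simp [hb]
    · exact ((hS b).mono (by omega)).congr fun x => by simp [hb]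
  refine h1.and hw (const_and fun _ => ((hS a).mono (by omega)).and hw
    (forall_mem hw' _ (fun c _ => (hS c).not hw') ?_))
  rw [Nat.card_Ioo]
  omega

theorem length_encNat_le (a : ℕ) : (encNat a).length ≤ a + 1 := by
  rw [length_encNat]
  have : a.size ≤ a := Nat.size_le.2 Nat.lt_two_pow_self
  omega

/-- The length is a weighted count over pairs (element, predecessor), since the length of a codeword
depends only on the pair. -/
theorem length_encSet_filter_eq (hw : 2 ≤ w) {S : (ℕ → Bool) → Finset ℕ}
    (hS : ∀ a, HasDepth w D d (fun x => a ∈ S x)) (hS0 : ∀ x, 0 ∉ S x) {a : ℕ}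
    (ha : (a + 2) ^ 3 < 2 ^ w) (o : ℕ) :
    HasDepth w D (d + 5) (fun x => (encSet ((S x).filter (· ≤ a))).length = o) := by
  classical
  have ha' : a + 2 < 2 ^ w := (Nat.le_self_pow (by norm_num) _).trans_lt ha
  refine (sum_eq (by omega) (Finset.range a ×ˢ Finset.range a)
    (fun i => (encNat (i.1 + 1 - i.2)).length)
    (P := fun i x => Consecutive (S x) i.2 (i.1 + 1)) (fun i hi => ?_) ?_ o).congr fun x => ?_
  · simp only [Finset.mem_product, Finset.mem_range] at hi
    exact consecutive hw hS (by omega)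
  · calc ∑ i ∈ Finset.range a ×ˢ Finset.range a, (encNat (i.1 + 1 - i.2)).length
        ≤ ∑ _i ∈ Finset.range a ×ˢ Finset.range a, (a + 2) := by
          refine Finset.sum_le_sum fun i hi => ?_
          simp only [Finset.mem_product, Finset.mem_range] at hi
          have := length_encNat_le (i.1 + 1 - i.2)
          omega
      _ = a * a * (a + 2) := by simp
      _ ≤ (a + 2) * (a + 2) * (a + 2) := by gcongr <;> omega
      _ = (a + 2) ^ 3 := by ring
      _ < 2 ^ w := ha
  · rw [length_encSet_filter (hS0 x), Finset.sum_product]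
    refine Eq.congr_left (Finset.sum_congr rfl fun b hb => ?_)
    rw [Finset.mem_range] at hb
    simp only [consecutive_iff (Nat.succ_pos b)]
    by_cases h : b + 1 ∈ S x
    · simp only [h, true_and, if_true]
      -- The predecessor is unique, so the inner sum has a single nonzero term.
      rw [Finset.sum_ite_eq', if_pos]
      rw [Finset.mem_range]
      have := ((consecutive_iff (Nat.succ_pos b)).2 ⟨h, rfl⟩).2.1
      omega
    · simp [h]

/-- Once element, predecessor and offset are guessed, the digit test no longer depends on the wires.
-/
theorem getElem?_encSet_eq (hw : 2 ≤ w) {S : (ℕ → Bool) → Finset ℕ} {U T : ℕ}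
    (hS : ∀ a, HasDepth w D d (fun x => a ∈ S x)) (hSU : ∀ x, ∀ a ∈ S x, 0 < a ∧ a ≤ U)
    (hcap : (U + T + 2) ^ 4 < 2 ^ w) {p : ℕ} (hp : p < T) (t : Fin 3) :
    HasDepth w D (d + 8) (fun x => (encSet (S x))[p]? = some t) := by
  have hS0 : ∀ x, 0 ∉ S x := fun x h => (hSU x 0 h).1.false
  have hcap3 : (U + T + 2) ^ 3 < 2 ^ w :=
    lt_of_le_of_lt (Nat.pow_le_pow_right (by omega) (by norm_num)) hcap
  refine (exists_mem (by omega)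
    (Finset.range U ×ˢ Finset.range U ×ˢ Finset.range (p + 1))
    (P := fun i x => (encNat (i.1 + 1 - i.2.1))[p - i.2.2]? = some t ∧
      (Consecutive (S x) i.2.1 (i.1 + 1) ∧
        (encSet ((S x).filter (· ≤ i.1))).length = i.2.2)) (fun i hi => ?_) ?_).congr fun x => ?_
  · simp only [Finset.mem_product, Finset.mem_range] at hi
    have ha : (i.1 + 2) ^ 3 < 2 ^ w := by
      refine lt_of_le_of_lt ?_ hcap3
      gcongr
      omega
    have ha' : i.1 + 2 < 2 ^ w := (Nat.le_self_pow (by norm_num) _).trans_lt ha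
    exact const_and fun _ => ((consecutive hw hS (by omega)).mono (by omega)).and hw
      (length_encSet_filter_eq hw hS hS0 ha i.2.2)
  · simp only [Finset.card_product, Finset.card_range]
    refine lt_of_le_of_lt ?_ hcap3
    calc U * (U * (p + 1)) ≤ (U + T + 2) * ((U + T + 2) * (U + T + 2)) := by gcongr <;> omega
      _ = (U + T + 2) ^ 3 := by ring
  · have hfil : (S x).filter (· ≤ U) = S x :=
      Finset.filter_true_of_mem fun a ha => (hSU x a ha).2
    conv_rhs => rw [← hfil]
    rw [getElem?_encSet_filter (hS0 x)]
    constructor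
    · rintro ⟨⟨a, c, o⟩, hi, h1, h2, h3⟩
      simp only [Finset.mem_product, Finset.mem_range] at hi h1 h2 h3
      rw [consecutive_iff (Nat.succ_pos a)] at h2
      obtain ⟨h2, rfl⟩ := h2
      subst h3
      exact ⟨a, hi.1, h2, by omega, h1⟩
    · rintro ⟨a, ha, h1, h2, h3⟩
      have h4 := (consecutive_iff (Nat.succ_pos a)).2 ⟨h1, rfl⟩
      refine ⟨⟨a, predIn (S x) (a + 1), _⟩, ?_, h3, h4, rfl⟩
      have : predIn (S x) (a + 1) < a + 1 := h4.2.1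
      simp only [Finset.mem_product, Finset.mem_range]
      omega

/-- The bits of a register that contains the encoding of a set. -/
theorem getD_encReg (hw : 2 ≤ w) {S : (ℕ → Bool) → Finset ℕ} {U T : ℕ} (n : ℕ)
    (hS : ∀ a, HasDepth w D d (fun x => a ∈ S x)) (hSU : ∀ x, ∀ a ∈ S x, 0 < a ∧ a ≤ U)
    (hcap : (U + T + 2) ^ 4 < 2 ^ w) (i : ℕ) (hi : i < 2 * T) :
    HasDepth w D (d + 8)
      (fun x => ((encReg n (S x)).flatMap tritBits).getD i false = true) := by
  -- Only the symbols `1` and `2` set a bit, so padding cannot be told apart from a missing symbol.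
  have hpad : ∀ (S : Finset ℕ) (p : ℕ) (t : Fin 3), t ≠ 0 →
      ((encReg n S)[p]? = some t ↔ (encSet S)[p]? = some t) := by
    intro S p t ht
    rw [encReg, List.rightpad]
    rcases lt_or_ge p (encSet S).length with h | h
    · rw [List.getElem?_append_left h]
    · rw [List.getElem?_append_right h, List.getElem?_eq_none h]
      simp only [reduceCtorEq, iff_false]
      intro h'
      have := List.mem_of_getElem? h'
      rw [List.mem_replicate] at this
      exact ht this.2
  obtain ⟨p, rfl | rfl⟩ := Nat.even_or_odd' i
  · refine (getElem?_encSet_eq hw hS hSU hcap (p := p) (by omega) 1).congr fun x => ?_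
    rw [(getD_flatMap_tritBits _ p).1, decide_eq_true_eq, hpad _ _ _ (by decide)]
  · refine (getElem?_encSet_eq hw hS hSU hcap (p := p) (by omega) 2).congr fun x => ?_
    rw [(getD_flatMap_tritBits _ p).2, decide_eq_true_eq, hpad _ _ _ (by decide)]

end HasDepth


/-! ### Selecting a variable -/

/-- Phrasing "first" through `idxOf` involves only the distinct members of the list, so repeated
clauses cost nothing. -/
theorem find?_eq_some_iff_idxOf {α : Type*} [DecidableEq α] {p : α → Bool} {l : List α} {a : α} :
    l.find? p = some a ↔ a ∈ l ∧ p a = true ∧ ∀ b ∈ l, l.idxOf b < l.idxOf a → p b = false := by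
  induction l with
  | nil => simp
  | cons c l ih =>
    by_cases hc : p c = true
    · rw [List.find?_cons_of_pos hc, Option.some.injEq]
      constructor
      · rintro rfl
        exact ⟨by simp, hc, fun b _ h => by simp at h⟩
      · rintro ⟨-, -, h⟩
        by_contra hca
        have := h c (by simp) (by simp [List.idxOf_cons_ne _ hca])
        rw [hc] at this
        exact Bool.noConfusion this
    · rw [List.find?_cons_of_neg hc, ih]
      constructor
      · rintro ⟨h1, h2, h3⟩
        have hca : c ≠ a := by rintro rfl; exact hc h2
        refine ⟨by simp [h1], h2, fun b hb hlt => ?_⟩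
        by_cases hcb : c = b
        · subst hcb; simpa using hc
        · rw [List.idxOf_cons_ne _ hca, List.idxOf_cons_ne _ hcb] at hlt
          refine h3 b ?_ (by omega)
          simpa [Ne.symm hcb] using hb
      · rintro ⟨h1, h2, h3⟩
        have hca : c ≠ a := by rintro rfl; exact hc h2
        refine ⟨by simpa [hca.symm] using h1, h2, fun b hb hlt => ?_⟩
        by_cases hcb : c = b
        · subst hcb; simpa using hc
        · refine h3 b (by simp [hb]) ?_
          rw [List.idxOf_cons_ne _ hca, List.idxOf_cons_ne _ hcb]
          omega

/-- In a strictly increasing list the position of an entry is the number of smaller ones, which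
turns selection by rank into counting. -/
theorem getElem?_eq_some_iff_of_pairwise {l : List ℕ} (h : l.Pairwise (· < ·)) {c a : ℕ} :
    l[c]? = some a ↔ a ∈ l ∧ l.countP (fun b => decide (b < a)) = c := by
  induction l generalizing c with
  | nil => simp
  | cons b l ih =>
    rw [List.pairwise_cons] at h
    rw [List.countP_cons, List.mem_cons]
    cases c with
    | zero =>
      simp only [List.getElem?_cons_zero, Option.some.injEq]
      constructor
      · rintro rfl
        refine ⟨Or.inl rfl, ?_⟩
        simp only [lt_irrefl, decide_false, Bool.false_eq_true, if_false, add_zero,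
          List.countP_eq_zero, decide_eq_true_eq, not_lt]
        exact fun e he => (h.1 e he).le
      · rintro ⟨rfl | h1, h2⟩
        · rfl
        · have := h.1 a h1
          simp [this] at h2
    | succ c =>
      rw [List.getElem?_cons_succ, ih h.2]
      constructor
      · rintro ⟨h1, h2⟩
        exact ⟨Or.inr h1, by simp [h.1 a h1, h2]⟩
      · rintro ⟨rfl | h1, h2⟩
        · exfalso
          have : l.countP (fun e => decide (e < a)) = 0 := by
            simp only [List.countP_eq_zero, decide_eq_true_eq, not_lt]
            exact fun e he => (h.1 e he).le
          simp [this] at h2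
        · refine ⟨h1, ?_⟩
          simpa [h.1 a h1] using h2

theorem getElem?_sort_eq_some_iff {S : Finset ℕ} {c a : ℕ} :
    (S.sort (· ≤ ·))[c]? = some a ↔ a ∈ S ∧ (S.filter (· < a)).card = c := by
  rw [getElem?_eq_some_iff_of_pairwise (Finset.sortedLT_sort S).pairwise, Finset.mem_sort]
  refine and_congr_right fun _ => Eq.congr_left ?_
  rw [List.countP_eq_length_filter, ← Multiset.coe_card, ← Multiset.filter_coe, Finset.sort_eq]
  rfl

/-- The choice `c` selects the variable `a` of the first clause that `x(V)` does not satisfy. -/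
def Selects {n : ℕ} (F : Formula n) (V : Finset ℕ) (c : ℕ) (a : ℕ) : Prop :=
  ∃ C ∈ F, F.find? (fun C => !C.sat (assignment n V)) = some C ∧
    ((C.vars \ V).sort (· ≤ ·))[c]? = some a

theorem Selects.le {n : ℕ} {F : Formula n} {V : Finset ℕ} {c a : ℕ} (h : Selects F V c a) :
    0 < a ∧ a ≤ n := by
  obtain ⟨C, -, -, h⟩ := h
  rw [getElem?_sort_eq_some_iff, Finset.mem_sdiff] at h
  obtain ⟨p, -, hp⟩ := Finset.mem_image.1 h.1.1
  rw [← hp]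
  have := p.1.isLt
  unfold index
  omega

/-- Since `i` is positive, the dummy `n + i` lies outside `1, …, n` and cannot coincide with a
selected variable. -/
theorem nextVar_eq_iff {n : ℕ} {F : Formula n} {V : Finset ℕ} {i : ℕ} (hi : 0 < i) (c : Fin 3)
    (a : ℕ) : nextVar F V i c = a ↔
      if a = n + i then ∀ b ∈ Finset.Icc 1 n, ¬Selects F V c b else Selects F V c a := by
  have key : Selects F V c (nextVar F V i c) ∨
      nextVar F V i c = n + i ∧ ∀ b, ¬Selects F V c b := by
    unfold nextVar
    split
    · rename_i C hC
      by_cases h : (c : ℕ) < ((C.vars \ V).sort (· ≤ ·)).length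
      · left
        exact ⟨C, List.mem_of_find?_eq_some hC, hC,
          by rw [List.getD_eq_getElem _ _ h, List.getElem?_eq_getElem h]⟩
      · right
        rw [List.getD_eq_default _ _ (by omega)]
        refine ⟨rfl, fun b hb => ?_⟩
        obtain ⟨C', -, hC', hb⟩ := hb
        rw [hC, Option.some.injEq] at hC'
        subst hC'
        rw [List.getElem?_eq_none (by omega)] at hb
        exact Option.noConfusion rfl (heq_of_eq hb)
    · rename_i hC
      refine Or.inr ⟨rfl, fun b hb => ?_⟩
      obtain ⟨C', -, hC', -⟩ := hb
      rw [hC] at hC'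
      exact Option.noConfusion rfl (heq_of_eq hC')
  have huniq : ∀ a b, Selects F V c a → Selects F V c b → a = b := by
    rintro a b ⟨C, -, hC, ha⟩ ⟨C', -, hC', hb⟩
    rw [hC, Option.some.injEq] at hC'
    subst hC'
    rw [ha, Option.some.injEq] at hb
    exact hb
  rcases key with h | ⟨h, h'⟩
  · have hb := h.le
    split_ifs with ha
    · constructor
      · omega
      · intro hall
        exact absurd h (hall _ (Finset.mem_Icc.2 hb))
    · exact ⟨fun e => e ▸ h, fun e => huniq _ _ h e⟩
  · rw [h]
    split_ifs with ha
    · exact ⟨fun _ b _ => h' b, fun _ => ha.symm⟩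
    · exact ⟨fun e => absurd e.symm ha, fun e => absurd e (h' a)⟩

/-- A formula contains polynomially many different clauses. -/
theorem card_clauses_le {n : ℕ} (s : Finset (Clause n)) : s.card ≤ 4 * (2 * n) ^ 3 + 1 := by
  classical
  -- For `n = 0` the power vanishes, and the summand `1` accounts for the empty clause.
  rcases Nat.eq_zero_or_pos n with rfl | hn
  · refine (Finset.card_le_one.2 fun C _ C' _ => ?_).trans (by omega)
    obtain ⟨l, _⟩ := C
    obtain ⟨l', _⟩ := C'
    have : l = l' := Subsingleton.elim _ _
    subst this
    rfl
  have hinj : Function.Injective (Clause.lits (n := n)) := by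
    rintro ⟨l, _⟩ ⟨l', _⟩ h
    simp only at h
    subst h
    rfl
  rw [← Finset.card_image_of_injective s hinj]
  have hsub : s.image Clause.lits ⊆ (Finset.range 4).biUnion fun j =>
      Finset.powersetCard j (Finset.univ : Finset (Fin n × Bool)) := by
    intro l hl
    obtain ⟨C, -, rfl⟩ := Finset.mem_image.1 hl
    simp only [Finset.mem_biUnion, Finset.mem_range, Finset.mem_powersetCard_univ]
    exact ⟨_, Nat.lt_succ_of_le C.card_le, rfl⟩
  refine (Finset.card_le_card hsub).trans (Finset.card_biUnion_le.trans ?_)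
  have hterm : ∀ j ∈ Finset.range 4,
      (Finset.powersetCard j (Finset.univ : Finset (Fin n × Bool))).card ≤ (2 * n) ^ 3 := by
    intro j hj
    rw [Finset.mem_range] at hj
    rw [Finset.card_powersetCard, Finset.card_univ, Fintype.card_prod, Fintype.card_fin,
      Fintype.card_bool, mul_comm n 2]
    exact (Nat.choose_le_pow _ _).trans (Nat.pow_le_pow_right (by omega) (by omega))
  refine (Finset.sum_le_card_nsmul _ _ _ hterm).trans ?_
  simp

namespace HasDepth

variable {w d n : ℕ} {D : Set ℕ}

theorem sat (hw : 2 ≤ w) {V : (ℕ → Bool) → Finset ℕ}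
    (hV : ∀ a, HasDepth w D d (fun x => a ∈ V x)) (C : Clause n) :
    HasDepth w D (d + 3) (fun x => C.sat (assignment n (V x)) = true) := by
  refine (exists_mem (by omega) C.lits
    (P := fun p x => assignment n (V x) p.1 = p.2) (fun p _ => ?_) ?_).congr fun x => ?_
  · obtain ⟨a, b⟩ := p
    cases b
    · exact ((hV (index a)).not (by omega)).congr fun x => by simp [assignment]
    · exact ((hV (index a)).mono (by omega)).congr fun x => by simp [assignment]
  · have : 2 ^ 2 ≤ 2 ^ w := Nat.pow_le_pow_right (by norm_num) hw
    have := C.card_le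
    omega
  · simp [Clause.sat]

/-- Both clause quantifiers range over `F.toFinset`, whose size is polynomial in `n` whatever the
length of `F`. -/
theorem selects (hw : 2 ≤ w) {V : (ℕ → Bool) → Finset ℕ}
    (hV : ∀ a, HasDepth w D d (fun x => a ∈ V x)) (F : Formula n)
    (hcap : 4 * (2 * n) ^ 3 + 1 < 2 ^ w) (c a : ℕ) :
    HasDepth w D (d + 8) (fun x => Selects F (V x) c a) := by
  classical
  have hw' : 0 < w := by omega
  have hclauses : ∀ s : Finset (Clause n), s.card < 2 ^ w := fun s =>
    (card_clauses_le s).trans_lt hcap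
  refine (exists_mem hw' F.toFinset (P := fun C x => a ∈ C.vars ∧
    ((C.sat (assignment n (V x)) ≠ true ∧
      ∀ C' ∈ F.toFinset.filter (fun C' => F.idxOf C' < F.idxOf C),
        C'.sat (assignment n (V x)) = true) ∧
    a ∉ V x ∧ ((C.vars.filter (· < a)).filter (· ∉ V x)).card = c))
    (fun C _ => const_and fun _ => ?_) (hclauses _)).congr fun x => ?_
  · have hcard : (C.vars.filter (· < a)).card < 2 ^ w := by
      have h1 : (C.vars.filter (· < a)).card ≤ 3 :=
        (Finset.card_filter_le _ _).trans (Finset.card_image_le.trans C.card_le)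
      have : 2 ^ 2 ≤ 2 ^ w := Nat.pow_le_pow_right (by norm_num) hw
      omega
    have hcount : HasDepth w D (d + 2)
        (fun x => ((C.vars.filter (· < a)).filter (· ∉ V x)).card = c) :=
      (card_eq hw' _ (fun b _ => (hV b).not hw') hcard c).congr fun x => by congr!
    exact and hw (d := d + 5) (and hw (d := d + 4) ((sat hw hV C).not hw')
      (forall_mem hw' _ (fun C' _ => sat hw hV C') (hclauses _)))
      (and hw (d := d + 4) (((hV a).not hw').mono (by omega)) (hcount.mono (by omega)))
  · unfold Selects
    simp only [List.mem_toFinset, Finset.mem_filter, find?_eq_some_iff_idxOf,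
      getElem?_sort_eq_some_iff, Finset.mem_sdiff]
    refine exists_congr fun C => and_congr_right fun hC => ?_
    have : (C.vars.filter (· < a)).filter (· ∉ V x) = (C.vars \ V x).filter (· < a) := by
      ext b
      simp only [Finset.mem_filter, Finset.mem_sdiff]
      tauto
    rw [this]
    simp only [Bool.not_eq_true', Bool.not_eq_false', hC, true_and, and_imp, ne_eq,
      Bool.not_eq_true]
    tauto

/-- The choice is guessed among three values, so that in each case it enters as a constant. -/
theorem nextVar_eq (hw : 2 ≤ w) {V : (ℕ → Bool) → Finset ℕ} (hd : 2 ≤ d)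
    (hV : ∀ a, HasDepth w D d (fun x => a ∈ V x)) (F : Formula n)
    (hcap : 4 * (2 * n) ^ 3 + 1 < 2 ^ w) {b T p : ℕ} (hD : regWires b T ⊆ D) (hp : p < T)
    (a : ℕ) :
    HasDepth w D (d + 13) (fun x => nextVar F (V x) (p + 1) (readTrit b x p) = a) := by
  have hw' : 0 < w := by omega
  have hn : n < 2 ^ w := by
    refine lt_of_le_of_lt ?_ hcap
    calc n ≤ 2 * n := by omega
      _ ≤ (2 * n) ^ 3 := Nat.le_self_pow (by norm_num) _
      _ ≤ 4 * (2 * n) ^ 3 + 1 := by omega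
  have hc : ∀ c : Fin 3, HasDepth w D (d + 10) (fun x => nextVar F (V x) (p + 1) c = a) := by
    intro c
    simp only [nextVar_eq_iff (Nat.succ_pos p)]
    split_ifs
    · exact forall_mem hw' _ (fun b _ => (selects hw hV F hcap c b).not hw') (by simpa)
    · exact (selects hw hV F hcap c a).mono (by omega)
  refine (exists_mem hw' Finset.univ (fun c _ =>
    ((readTrit_eq hw hD hp c).mono (by omega)).and hw (hc c)) ?_).congr fun x => ?_
  · have : 2 ^ 2 ≤ 2 ^ w := Nat.pow_le_pow_right (by norm_num) hw
    simp
    omega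
  · simp

end HasDepth


/-! ### Computing into a register -/

/-- Add the bits `v` to the register of `k` wires that begins at the wire `o`. -/
def xorReg (o k : ℕ) (v : ℕ → Bool) (x : ℕ → Bool) : ℕ → Bool :=
  fun i => if o ≤ i ∧ i < o + k then xor (x i) (v (i - o)) else x i

/-- Replace the content of the register of `k` wires that begins at the wire `o` by `v`. -/
def setReg (o k : ℕ) (v : ℕ → Bool) (x : ℕ → Bool) : ℕ → Bool :=
  fun i => if o ≤ i ∧ i < o + k then v (i - o) else x i

theorem xorReg_of_notMem {o k i : ℕ} {v x : ℕ → Bool} (h : i < o ∨ o + k ≤ i) :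
    xorReg o k v x i = x i := if_neg (by omega)

theorem setReg_of_notMem {o k i : ℕ} {v x : ℕ → Bool} (h : i < o ∨ o + k ≤ i) :
    setReg o k v x i = x i := if_neg (by omega)

theorem xorReg_eq_setReg {o k : ℕ} {v x : ℕ → Bool}
    (hx : ∀ i, o ≤ i → i < o + k → x i = false) : xorReg o k v x = setReg o k v x := by
  funext i
  unfold xorReg setReg
  split_ifs with h
  · rw [hx i h.1 h.2, Bool.false_xor]
  · rfl

/-- A circuit with at most `g` gates adds `E x` to the register of `k` wires that begins at the
wire `o`, using the `a` wires from `N` on as ancillas. -/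
def ComputesInto (N a g o k : ℕ) (E : (ℕ → Bool) → ℕ → Bool) : Prop :=
  ∃ c : List WireGate, c.length ≤ g ∧ (∀ g ∈ c, g.Ok (N + a)) ∧
    ∀ x : ℕ → Bool, (∀ i, N ≤ i → i < N + a → x i = false) →
      runWires c x = xorReg o k (E x) x

theorem ComputesInto.mono {N a g o k a' g' : ℕ} {E : (ℕ → Bool) → ℕ → Bool}
    (h : ComputesInto N a g o k E) (ha : a ≤ a') (hg : g ≤ g') :
    ComputesInto N a' g' o k E := by
  obtain ⟨c, h1, h2, h3⟩ := h
  exact ⟨c, h1.trans hg, fun g hg => (h2 g hg).mono (by omega),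
    fun x hx => h3 x fun i hi hi' => hx i hi (by omega)⟩

/-- Bits are added one at a time. None depends on the output wires, so those already written do not
disturb the later ones. -/
theorem HasDepth.computesInto {w d N o k : ℕ} {D : Set ℕ} {E : (ℕ → Bool) → ℕ → Bool}
    (hE : ∀ j < k, HasDepth w D d (fun x => E x j = true)) (ho : o + k ≤ N)
    (hD : ∀ i ∈ D, i < N ∧ (i < o ∨ o + k ≤ i)) :
    ComputesInto N (d * (2 * w + 1)) (k * 2 ^ (8 * w * d)) o k E := by
  induction k with
  | zero => exact ⟨[], by simp, by simp, fun x _ => funext fun i => by simp [xorReg]⟩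
  | succ k ih =>
    obtain ⟨c, h1, h2, h3⟩ := ih (fun j hj => hE j (by omega)) (by omega)
      (fun i hi => by have := hD i hi; omega)
    have hEk := hE k (by omega)
    obtain ⟨b, g1, g2, g3⟩ := hEk.2 (o + k) N (fun h => by have := hD _ h; omega) (by omega)
      (fun i hi => (hD i hi).1)
    refine ⟨c ++ b, ?_, ?_, fun x hx => ?_⟩
    · rw [List.length_append, Nat.succ_mul]
      omega
    · intro g hg
      rcases List.mem_append.1 hg with hg | hg
      · exact h2 g hg
      · exact g2 g hg
    · rw [runWires_append, h3 x hx, g3]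
      · have : (E (xorReg o k (E x) x) k = true) = (E x k = true) :=
          hEk.1 fun i hi => xorReg_of_notMem (by have := hD i hi; omega)
        simp only [this, Bool.decide_eq_true]
        funext i
        rw [Function.update_apply]
        split_ifs with hi
        · subst hi
          simp [xorReg]
        · unfold xorReg
          split_ifs <;> first | rfl | omega
      · intro i hi hi'
        rw [xorReg_of_notMem (by omega)]
        exact hx i hi hi'

/-! ### Selected variables -/

theorem flipList_append_singleton {n : ℕ} (F : Formula n) (s : List (Fin 3)) (c : Fin 3) :
    flipList F (s ++ [c]) =
      flipList F s ++ [nextVar F (flipList F s).toFinset (s.length + 1) c] := by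
  rw [← (flipList_spec F s).1]
  simp [flipList]

theorem take_one_drop_flipList {n : ℕ} (F : Formula n) (s : List (Fin 3)) {i : ℕ}
    (hi : i < s.length) : ((flipList F s).drop i).take 1 =
      [nextVar F ((flipList F s).take i).toFinset (i + 1) s[i]] := by
  induction s using List.reverseRecOn with
  | nil => simp at hi
  | append_singleton s c ih =>
    have hlen := (flipList_spec F s).1
    rw [flipList_append_singleton]
    rcases Nat.lt_or_ge i s.length with h | h
    · rw [List.drop_append_of_le_length (by omega),
        List.take_append_of_le_length (by simp; omega), ih h,
        List.take_append_of_le_length (by omega), List.getElem_append_left h]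
    · have : i = s.length := by simp at hi; omega
      subst this
      rw [List.drop_append_of_le_length (by omega), List.take_append_of_le_length (i := s.length)
        (by omega), List.drop_of_length_le (by omega), List.take_of_length_le (i := s.length)
        (by omega)]
      simp

/-- The variables selected in the rounds `i + 1, …, i + m`. -/
def roundSet {n : ℕ} (F : Formula n) (s : List (Fin 3)) (i m : ℕ) : Finset ℕ :=
  (((flipList F s).drop i).take m).toFinset

theorem roundSet_union {n : ℕ} (F : Formula n) (s : List (Fin 3)) (i m m' : ℕ) :
    roundSet F s i m ∪ roundSet F s (i + m) m' = roundSet F s i (m + m') := by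
  rw [roundSet, roundSet, roundSet, ← List.toFinset_append, List.take_add, List.drop_drop]

theorem roundSet_spec {n : ℕ} (F : Formula n) {s : List (Fin 3)} (hs : s.length ≤ n) {i m : ℕ}
    (him : i + m ≤ s.length) :
    (roundSet F s i m).card = m ∧ ∀ y ∈ roundSet F s i m, 0 < y ∧ y ≤ 2 * n := by
  obtain ⟨h1, h2, h3⟩ := flipList_spec F s
  have hsub : (((flipList F s).drop i).take m).Sublist (flipList F s) :=
    (List.take_sublist _ _).trans (List.drop_sublist _ _)
  refine ⟨?_, fun y hy => ?_⟩
  · rw [roundSet, List.toFinset_card_of_nodup (h2.sublist hsub), List.length_take,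
      List.length_drop, h1]
    omega
  · have := h3 y (hsub.subset (List.mem_toFinset.1 hy))
    omega

theorem length_encReg_roundSet {n : ℕ} (F : Formula n) {s : List (Fin 3)} (hs : s.length ≤ n)
    {i m : ℕ} (him : i + m ≤ s.length) :
    (encReg n (roundSet F s i m)).length = encLen n m := by
  obtain ⟨h1, h2⟩ := roundSet_spec F hs him
  have h := length_encSet_le (roundSet F s i m) h2 (by omega)
  rw [encReg, List.length_rightpad, max_eq_left h, h1]

/-- Dummies reach up to `n + r ≤ 2 * n`, hence the decoding bound `2 * n`. -/
theorem Holds.decodeSet_roundSet {n : ℕ} {F : Formula n} {s : List (Fin 3)} (hs : s.length ≤ n)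
    {i m b : ℕ} (him : i + m ≤ s.length) {x : ℕ → Bool}
    (h : Holds b (encLen n m) (encReg n (roundSet F s i m)) x) :
    decodeSet (2 * n) (readTrits b (encLen n m) x) = roundSet F s i m := by
  rw [h.readTrits_eq (length_encReg_roundSet F hs him), encReg, List.rightpad]
  exact decodeSet_encSet (roundSet_spec F hs him).2 _

theorem readTrits_congr {b T : ℕ} {x y : ℕ → Bool} (h : ∀ i ∈ regWires b T, x i = y i) :
    readTrits b T x = readTrits b T y := by
  refine List.map_congr_left fun p hp => ?_
  rw [List.mem_range] at hp
  rw [readTrit, readTrit, h _ ⟨by omega, by omega⟩, h _ ⟨by omega, by omega⟩]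

theorem decodeRegs_congr {U : ℕ} {regs : List (ℕ × ℕ)} {x y : ℕ → Bool}
    (h : ∀ g ∈ regs, ∀ i ∈ regWires g.1 g.2, x i = y i) :
    decodeRegs U regs x = decodeRegs U regs y := by
  unfold decodeRegs
  refine Finset.biUnion_congr rfl fun g hg => ?_
  rw [readTrits_congr (h g (List.mem_toFinset.1 hg))]

theorem decodeRegs_append_singleton (U : ℕ) (regs : List (ℕ × ℕ)) (b T : ℕ) (x : ℕ → Bool) :
    decodeRegs U (regs ++ [(b, T)]) x =
      decodeRegs U regs x ∪ decodeSet U (readTrits b T x) := by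
  classical
  unfold decodeRegs
  ext a
  simp [or_comm]

/-! ### Blocks of rounds -/

/-- The wires that hold the choices of `r` rounds and the registers of a list. -/
def inputWires (r : ℕ) (regs : List (ℕ × ℕ)) : Set ℕ :=
  {i | i < 2 * r ∨ ∃ g ∈ regs, i ∈ regWires g.1 g.2}

/-- The content of a register for the set `S`. -/
noncomputable def regBits (n : ℕ) (S : Finset ℕ) (j : ℕ) : Bool :=
  ((encReg n S).flatMap tritBits).getD j false

/-- The number of ancillas for a block of `2 ^ e` rounds. -/
noncomputable def blockAncillas (n w : ℕ) : ℕ → ℕ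
  | 0 => 31 * (2 * w + 1)
  | e + 1 => 4 * encLen n (2 ^ e) + blockAncillas n w e

theorem le_blockAncillas (n w e : ℕ) : 31 * (2 * w + 1) ≤ blockAncillas n w e := by
  induction e with
  | zero => exact le_rfl
  | succ e ih => exact ih.trans (Nat.le_add_left _ _)

/-- Given registers for the variables selected in the first `i₀` rounds, the variables selected in
the next `2 ^ e` rounds can be computed into a register. -/
theorem exists_block {n r w T : ℕ} (F : Formula n) (hr : r ≤ n) (hw : 2 ≤ w)
    (hT : ∀ e, 2 ^ e ≤ n → encLen n (2 ^ e) ≤ T) (hcap : (2 * n + T + 2) ^ 4 < 2 ^ w)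
    (e i₀ : ℕ) (hi₀ : i₀ + 2 ^ e ≤ r) (regs : List (ℕ × ℕ)) (hlen : regs.length ≤ i₀)
    (hregs : ∀ g ∈ regs, g.2 ≤ T) (N o : ℕ) (ho : o + 2 * encLen n (2 ^ e) ≤ N)
    (hD : ∀ i ∈ inputWires r regs, i < N ∧ (i < o ∨ o + 2 * encLen n (2 ^ e) ≤ i)) :
    ∃ E : (ℕ → Bool) → ℕ → Bool, DependsOn E (inputWires r regs) ∧
      ComputesInto N (blockAncillas n w e) (8 ^ e * (2 ^ w * 2 ^ (8 * w * 31))) o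
        (2 * encLen n (2 ^ e)) E ∧
      ∀ (x : ℕ → Bool) (s : List (Fin 3)), s.length = r → Holds 0 r s x →
        decodeRegs (2 * n) regs x = roundSet F s 0 i₀ →
        E x = regBits n (roundSet F s i₀ (2 ^ e)) := by
  have hn : 1 ≤ n := by have := Nat.one_le_two_pow (n := e); omega
  have hX : 2 * n + T + 2 < 2 ^ w := (Nat.le_self_pow (by norm_num) _).trans_lt hcap
  have hgates : ∀ e, 2 ^ e ≤ n → 2 * encLen n (2 ^ e) ≤ 2 ^ w := by
    intro e he
    have := hT e he
    have h1 : (2 * n + T + 2) ^ 2 ≤ (2 * n + T + 2) ^ 4 :=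
      Nat.pow_le_pow_right (by omega) (by norm_num)
    nlinarith
  induction e generalizing i₀ regs N o with
  | zero =>
    rw [pow_zero] at hi₀ ho hD ⊢
    set D := inputWires r regs
    -- The fourth power in `hcap` absorbs the factor `4`, because `2 * n + T + 2 ≥ 4`.
    have hcap' : 4 * (2 * n) ^ 3 + 1 < 2 ^ w := by
      refine lt_of_le_of_lt ?_ hcap
      calc 4 * (2 * n) ^ 3 + 1 ≤ 4 * (2 * n + 1) ^ 3 := by nlinarith [sq_nonneg n]
        _ ≤ (2 * n + T + 2) * (2 * n + T + 2) ^ 3 := by gcongr <;> omega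
        _ = (2 * n + T + 2) ^ 4 := by ring
    have hs : regWires 0 r ⊆ D := fun i hi => Or.inl (by have := hi.2; omega)
    have hV : ∀ a, HasDepth w D 10 (fun x => a ∈ decodeRegs (2 * n) regs x) :=
      HasDepth.mem_decodeRegs hw (fun g hg i hi => Or.inr ⟨g, hg, hi⟩) hregs hcap (by omega)
    have hS : ∀ a, HasDepth w D 23 (fun x => a ∈
        ({nextVar F (decodeRegs (2 * n) regs x) (i₀ + 1) (readTrit 0 x i₀)} : Finset ℕ)) :=
      fun a => (HasDepth.nextVar_eq hw (by norm_num) hV F hcap' hs (p := i₀) (by omega) a).congr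
        fun x => by rw [Finset.mem_singleton, eq_comm]
    have hE := HasDepth.getD_encReg hw n hS (U := 2 * n) (T := T) (by
      intro x a ha
      rw [Finset.mem_singleton] at ha
      have := nextVar_spec F (decodeRegs (2 * n) regs x) (i₀ + 1) (readTrit 0 x i₀)
      rw [← ha] at this
      omega) hcap
    have hk : encLen n 1 ≤ T := hT 0 (by simpa)
    refine ⟨fun x => regBits n
      {nextVar F (decodeRegs (2 * n) regs x) (i₀ + 1) (readTrit 0 x i₀)}, ?_, ?_, ?_⟩
    · intro x y hxy
      have h1 : decodeRegs (2 * n) regs x = decodeRegs (2 * n) regs y :=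
        decodeRegs_congr fun g hg i hi => hxy i (Or.inr ⟨g, hg, hi⟩)
      have h2 : readTrit 0 x i₀ = readTrit 0 y i₀ := by
        rw [readTrit, readTrit, hxy _ (Or.inl (by omega)), hxy _ (Or.inl (by omega))]
      simp only [h1, h2]
    -- The depth is `31 = 10 + 13 + 8`: decoding the registers, selecting the variable, encoding it.
    · refine (HasDepth.computesInto (d := 31) (fun j hj => hE j (by omega)) ho hD).mono
        le_rfl ?_
      rw [one_mul]
      exact Nat.mul_le_mul_right _ (by simpa using hgates 0 (by simpa))
    · intro x s hsl hx hdec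
      have h1 := take_one_drop_flipList F s (i := i₀) (by omega)
      have h2 := hx.readTrit_eq (p := i₀) (by omega) (by omega)
      simp only [hdec, h2]
      rw [roundSet, roundSet, pow_zero, h1]
      simp
  | succ e ih =>
    set k := encLen n (2 ^ e) with hk
    set K := encLen n (2 ^ (e + 1)) with hK
    have hpow : 2 ^ (e + 1) = 2 ^ e + 2 ^ e := by ring
    have he : 1 ≤ 2 ^ e := Nat.one_le_two_pow
    have hkT : k ≤ T := hT e (by omega)
    have hKT : K ≤ T := hT (e + 1) (by omega)
    have hKw : 2 * K ≤ 2 ^ w := hgates (e + 1) (by omega)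
    have hAnc : blockAncillas n w (e + 1) = 4 * k + blockAncillas n w e := rfl
    -- Scratch layout: `2 * k` wires from `N` on for the first half, the next `2 * k` for the
    -- second. Both recursive calls use the same workspace from `N + 4 * k` on.
    obtain ⟨E₁, hdep₁, ⟨c₁, hl₁, hok₁, hrun₁⟩, hspec₁⟩ := ih i₀ (by omega) regs hlen hregs
      (N + 4 * k) N (by omega) (fun i hi => by have := hD i hi; omega)
    have hreg₂ : ∀ i ∈ inputWires r (regs ++ [(N, k)]),
        i ∈ inputWires r regs ∨ N ≤ i ∧ i < N + 2 * k := by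
      rintro i (hi | ⟨g, hg, hi⟩)
      · exact Or.inl (Or.inl hi)
      · rcases List.mem_append.1 hg with hg | hg
        · exact Or.inl (Or.inr ⟨g, hg, hi⟩)
        · rw [List.mem_singleton] at hg
          subst hg
          exact Or.inr hi
    obtain ⟨E₂, hdep₂, ⟨c₂, hl₂, hok₂, hrun₂⟩, hspec₂⟩ := ih (i₀ + 2 ^ e) (by omega)
      (regs ++ [(N, k)]) (by simp; omega)
      (fun g hg => by
        rcases List.mem_append.1 hg with hg | hg
        · exact hregs g hg
        · rw [List.mem_singleton] at hg
          subst hg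
          exact hkT)
      (N + 4 * k) (N + 2 * k) (by omega) (fun i hi => by
        rcases hreg₂ i hi with hi | hi
        · have := hD i hi; omega
        · omega)
    set both : List (ℕ × ℕ) := [(N, k), (N + 2 * k, k)] with hboth
    have hbothD : ∀ g ∈ both, regWires g.1 g.2 ⊆ Set.Ico N (N + 4 * k) := by
      intro g hg i hi
      simp only [hboth, List.mem_cons, List.not_mem_nil, or_false] at hg
      rcases hg with rfl | rfl <;> simp only [Set.mem_Ico] at hi ⊢ <;> omega
    have hV : ∀ a, HasDepth w (Set.Ico N (N + 4 * k)) 10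
        (fun x => a ∈ decodeRegs (2 * n) both x) :=
      HasDepth.mem_decodeRegs hw hbothD (by simp [hboth, hkT]) hcap (by
        simp only [hboth, List.length_cons, List.length_nil]; omega)
    have hE := HasDepth.getD_encReg hw n hV (T := T) (fun x a ha => mem_decodeRegs_bounds ha) hcap
    obtain ⟨c₃, hl₃, hok₃, hrun₃⟩ := ((HasDepth.computesInto (N := N + 4 * k) (o := o) (k := 2 * K)
      (E := fun x => regBits n (decodeRegs (2 * n) both x)) (d := 31)
      (fun j hj => (hE j (by omega)).mono (by norm_num)) (by omega) (fun i hi => by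
        have := hi.1; have := hi.2; omega)).mono (le_blockAncillas n w e)
        (Nat.mul_le_mul_right _ hKw))
    set x₁ : (ℕ → Bool) → ℕ → Bool := fun x => setReg N (2 * k) (E₁ x) x with hx₁
    set x₂ : (ℕ → Bool) → ℕ → Bool := fun x => setReg (N + 2 * k) (2 * k) (E₂ (x₁ x)) (x₁ x)
      with hx₂
    refine ⟨fun x => regBits n (decodeRegs (2 * n) both (x₂ x)), ?_, ?_, ?_⟩
    · intro x y hxy
      have h1 : E₁ x = E₁ y := hdep₁ hxy
      have h2 : E₂ (x₁ x) = E₂ (x₁ y) := by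
        refine hdep₂ fun i hi => ?_
        simp only [hx₁, setReg, h1]
        split_ifs with h
        · rfl
        · rcases hreg₂ i hi with hi | hi
          · exact hxy i hi
          · exact absurd hi h
      have h3 : decodeRegs (2 * n) both (x₂ x) = decodeRegs (2 * n) both (x₂ y) := by
        refine decodeRegs_congr fun g hg i hi => ?_
        have := hbothD g hg hi
        simp only [Set.mem_Ico] at this
        simp only [hx₂, hx₁, setReg, h1]
        have h2' := h2
        simp only [hx₁, h1] at h2'
        rw [h2']
        split_ifs <;> first | rfl | omega
      simp only [h3]
    -- Each circuit adds a function of wires it does not change, so a second run erases its result.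
    -- The second half is erased first, because it reads the register of the first. The five pieces
    -- explain the growth factor; `8` leaves slack.
    · refine ⟨c₁ ++ c₂ ++ c₃ ++ c₂ ++ c₁, ?_, ?_, fun x hx => ?_⟩
      · have h8 : 1 ≤ 8 ^ e := Nat.one_le_pow _ _ (by norm_num)
        generalize 2 ^ w * 2 ^ (8 * w * 31) = G at *
        have h9 : G ≤ 8 ^ e * G := Nat.le_mul_of_pos_left _ h8
        have h10 : 8 ^ (e + 1) * G = 8 * (8 ^ e * G) := by ring
        simp only [List.length_append]
        omega
      · intro g hg
        rw [hAnc, ← add_assoc]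
        simp only [List.mem_append] at hg
        rcases hg with (((hg | hg) | hg) | hg) | hg
        · exact hok₁ g hg
        · exact hok₂ g hg
        · exact hok₃ g hg
        · exact hok₂ g hg
        · exact hok₁ g hg
      · rw [hAnc, ← add_assoc] at hx
        have hr1 : runWires c₁ x = x₁ x := by
          rw [hrun₁ x fun i hi hi' => hx i (by omega) (by omega)]
          exact xorReg_eq_setReg fun i hi hi' => hx i (by omega) (by omega)
        have hr2 : runWires c₂ (x₁ x) = x₂ x := by
          rw [hrun₂ _ fun i hi hi' => by
            simp only [hx₁]
            rw [setReg_of_notMem (by omega)]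
            exact hx i (by omega) (by omega)]
          refine xorReg_eq_setReg fun i hi hi' => ?_
          simp only [hx₁]
          rw [setReg_of_notMem (by omega)]
          exact hx i (by omega) (by omega)
        have hx₂' : ∀ i, (i < N ∨ N + 4 * k ≤ i) → x₂ x i = x i := by
          intro i hi
          simp only [hx₂, hx₁]
          rw [setReg_of_notMem (by omega), setReg_of_notMem (by omega)]
        have hx₂'' : ∀ i, (i < N + 2 * k) → x₂ x i = x₁ x i := by
          intro i hi
          simp only [hx₂]
          rw [setReg_of_notMem (by omega)]
        set v := regBits n (decodeRegs (2 * n) both (x₂ x)) with hv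
        have hr3 : runWires c₃ (x₂ x) = xorReg o (2 * K) v (x₂ x) :=
          hrun₃ _ fun i hi hi' => by
            rw [hx₂' i (by omega)]
            exact hx i (by omega) (by omega)
        have hr4 : runWires c₂ (xorReg o (2 * K) v (x₂ x)) = xorReg o (2 * K) v (x₁ x) := by
          -- The output register and the second scratch register are disjoint from the inputs of
          -- `E₂`, so the same value is added again.
          have hE₂ : E₂ (xorReg o (2 * K) v (x₂ x)) = E₂ (x₁ x) := by
            refine hdep₂ fun i hi => ?_
            rcases hreg₂ i hi with hi | hi
            · have := hD i hi
              rw [xorReg_of_notMem (by omega), hx₂'' i (by omega)]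
            · rw [xorReg_of_notMem (by omega), hx₂'' i (by omega)]
          rw [hrun₂ _ fun i hi hi' => by
            rw [xorReg_of_notMem (by omega), hx₂' i (by omega)]
            exact hx i (by omega) (by omega), hE₂]
          funext i
          by_cases hi : N + 2 * k ≤ i ∧ i < N + 2 * k + 2 * k
          · have h1 : x₁ x i = false := by
              simp only [hx₁]
              rw [setReg_of_notMem (by omega)]
              exact hx i (by omega) (by omega)
            rw [xorReg, if_pos hi, xorReg_of_notMem (by omega), xorReg_of_notMem (by omega), h1]
            simp only [hx₂, setReg]
            rw [if_pos hi, Bool.xor_self]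
          · rw [xorReg_of_notMem (by omega)]
            simp only [xorReg, hx₂]
            rw [setReg_of_notMem (by omega)]
        have hr5 : runWires c₁ (xorReg o (2 * K) v (x₁ x)) = xorReg o (2 * K) v x := by
          have hE₁ : E₁ (xorReg o (2 * K) v (x₁ x)) = E₁ x := by
            refine hdep₁ fun i hi => ?_
            have := hD i hi
            rw [xorReg_of_notMem (by omega)]
            simp only [hx₁]
            rw [setReg_of_notMem (by omega)]
          rw [hrun₁ _ fun i hi hi' => by
            rw [xorReg_of_notMem (by omega)]
            simp only [hx₁]
            rw [setReg_of_notMem (by omega)]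
            exact hx i (by omega) (by omega), hE₁]
          funext i
          by_cases hi : N ≤ i ∧ i < N + 2 * k
          · rw [xorReg, if_pos hi, xorReg_of_notMem (by omega), xorReg_of_notMem (by omega),
              hx i (by omega) (by omega)]
            simp only [hx₁, setReg]
            rw [if_pos hi, Bool.xor_self]
          · rw [xorReg_of_notMem (by omega)]
            simp only [xorReg, hx₁]
            rw [setReg_of_notMem (by omega)]
        simp only [runWires_append]
        rw [hr1, hr2, hr3, hr4, hr5]
    · intro x s hsl hx hdec
      have hsn : s.length ≤ n := hsl ▸ hr
      have h1 := hspec₁ x s hsl hx hdec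
      have hold : ∀ b S y, (∀ i < 2 * k, y (b + i) = regBits n S i) →
          Holds b k (encReg n S) y := fun b S y h i hi => h i hi
      have hB₁ : decodeSet (2 * n) (readTrits N k (x₁ x)) = roundSet F s i₀ (2 ^ e) := by
        refine Holds.decodeSet_roundSet hsn (by omega) (hold _ _ _ fun i hi => ?_)
        simp only [hx₁, setReg, h1]
        rw [if_pos (by omega), Nat.add_sub_cancel_left]
      have hx₁D : ∀ i ∈ inputWires r regs, x₁ x i = x i := fun i hi => by
        have := hD i hi
        simp only [hx₁]
        rw [setReg_of_notMem (by omega)]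
      have h2 := hspec₂ (x₁ x) s hsl (fun i hi => by
          rw [← hx i hi]
          exact hx₁D _ (Or.inl (by omega))) (by
        rw [decodeRegs_append_singleton, hB₁,
          decodeRegs_congr (y := x) fun g hg i hi => hx₁D i (Or.inr ⟨g, hg, hi⟩), hdec]
        simpa using roundSet_union F s 0 i₀ (2 ^ e))
      have hB₂ : decodeSet (2 * n) (readTrits (N + 2 * k) k (x₂ x)) =
          roundSet F s (i₀ + 2 ^ e) (2 ^ e) := by
        refine Holds.decodeSet_roundSet hsn (by omega) (hold _ _ _ fun i hi => ?_)
        simp only [hx₂, setReg, h2]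
        rw [if_pos (by omega), Nat.add_sub_cancel_left]
      have hB₁' : readTrits N k (x₂ x) = readTrits N k (x₁ x) := by
        refine readTrits_congr fun i hi => ?_
        simp only [hx₂]
        rw [setReg_of_notMem (Or.inl hi.2)]
      have hdecode : decodeRegs (2 * n) both (x₂ x) = roundSet F s i₀ (2 ^ (e + 1)) := by
        have : both = ([] ++ [(N, k)]) ++ [(N + 2 * k, k)] := rfl
        rw [this, decodeRegs_append_singleton, decodeRegs_append_singleton, hB₁', hB₁, hB₂,
          hpow, ← roundSet_union]
        simp [decodeRegs]
      simp only [hdecode]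


/-! ### All rounds -/

theorem length_flatMap_tritBits (l : List (Fin 3)) :
    (l.flatMap tritBits).length = 2 * l.length := by
  induction l with
  | nil => rfl
  | cons t l ih =>
    rw [List.flatMap_cons, List.length_append, ih, List.length_cons, tritBits]
    simp only [List.length_cons, List.length_nil]
    ring

theorem Holds.append {b T T' : ℕ} {l l' : List (Fin 3)} {x : ℕ → Bool} (h : Holds b T l x)
    (hl : l.length = T) (h' : Holds (b + 2 * T) T' l' x) : Holds b (T + T') (l ++ l') x := by
  have hlen : (l.flatMap tritBits).length = 2 * T := by rw [length_flatMap_tritBits, hl]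
  intro i hi
  rw [List.flatMap_append]
  rcases lt_or_ge i (2 * T) with h1 | h1
  · rw [List.getD_append _ _ _ _ (by omega), h i h1]
  · rw [List.getD_append_right _ _ _ _ (by omega), hlen, ← h' (i - 2 * T) (by omega)]
    congr 1
    omega

/-- The contents of the registers for consecutive blocks of `2 ^ e` rounds, `e ∈ es`. -/
noncomputable def blocksEnc {n : ℕ} (F : Formula n) (s : List (Fin 3)) (i₀ : ℕ) (es : List ℕ) :
    List (Fin 3) :=
  ((es.map (2 ^ ·)).splitLengths ((flipList F s).drop i₀)).flatMap fun B => encReg n B.toFinset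

theorem blocksEnc_cons {n : ℕ} (F : Formula n) (s : List (Fin 3)) (i₀ e : ℕ) (es : List ℕ) :
    blocksEnc F s i₀ (e :: es) =
      encReg n (roundSet F s i₀ (2 ^ e)) ++ blocksEnc F s (i₀ + 2 ^ e) es := by
  simp [blocksEnc, roundSet]

/-- Consecutive blocks of rounds can be computed into consecutive registers. -/
theorem exists_blocks {n r w T a Q : ℕ} (F : Formula n) (hr : r ≤ n) (hw : 2 ≤ w)
    (hT : ∀ e, 2 ^ e ≤ n → encLen n (2 ^ e) ≤ T) (hcap : (2 * n + T + 2) ^ 4 < 2 ^ w) (N : ℕ)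
    (es : List ℕ) (ha : ∀ e ∈ es, blockAncillas n w e ≤ a)
    (hQ : ∀ e ∈ es, 8 ^ e * (2 ^ w * 2 ^ (8 * w * 31)) ≤ Q) (i₀ : ℕ)
    (hi₀ : i₀ + (es.map (2 ^ ·)).sum ≤ r) (regs : List (ℕ × ℕ)) (hlen : regs.length ≤ i₀)
    (hregs : ∀ g ∈ regs, g.2 ≤ T) (o : ℕ)
    (ho : o + 2 * (es.map fun e => encLen n (2 ^ e)).sum ≤ N)
    (hD : ∀ i ∈ inputWires r regs, i < o) :
    ∃ c : List WireGate, c.length ≤ es.length * Q ∧ (∀ g ∈ c, g.Ok (N + a)) ∧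
      ∀ x : ℕ → Bool, (∀ i, N ≤ i → i < N + a → x i = false) →
        (∀ i, (i < o ∨ o + 2 * (es.map fun e => encLen n (2 ^ e)).sum ≤ i) →
          runWires c x i = x i) ∧
        ∀ s : List (Fin 3), s.length = r → Holds 0 r s x →
          decodeRegs (2 * n) regs x = roundSet F s 0 i₀ →
          (∀ i, o ≤ i → i < o + 2 * (es.map fun e => encLen n (2 ^ e)).sum → x i = false) →
          Holds o (es.map fun e => encLen n (2 ^ e)).sum (blocksEnc F s i₀ es)
            (runWires c x) := by
  induction es generalizing i₀ regs o with
  | nil =>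
    refine ⟨[], by simp, by simp, fun x _ => ⟨fun i _ => rfl, fun s _ _ _ _ i hi => ?_⟩⟩
    simp at hi
  | cons e es ih =>
    simp only [List.mem_cons, forall_eq_or_imp, List.map_cons, List.sum_cons] at ha hQ hi₀ ho ⊢
    have he : 1 ≤ 2 ^ e := Nat.one_le_two_pow
    set k := encLen n (2 ^ e) with hk
    set t := (es.map fun e => encLen n (2 ^ e)).sum with ht
    have hkT : k ≤ T := hT e (by omega)
    obtain ⟨E, -, hcomp, hspec⟩ := exists_block F hr hw hT hcap e i₀ (by omega) regs hlen hregs N o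
      (by omega) (fun i hi => by have := hD i hi; omega)
    obtain ⟨c, hl, hok, hrun⟩ := hcomp.mono ha.1 hQ.1
    -- The output register just filled joins the inputs of the later blocks, so no copy of it is
    -- needed.
    obtain ⟨c', hl', hok', hrun'⟩ := ih ha.2 hQ.2 (i₀ + 2 ^ e) (by omega) (regs ++ [(o, k)])
      (by simp; omega) (fun g hg => by
        rcases List.mem_append.1 hg with hg | hg
        · exact hregs g hg
        · rw [List.mem_singleton] at hg
          subst hg
          exact hkT) (o + 2 * k) (by omega) (by
        rintro i (hi | ⟨g, hg, hi⟩)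
        · have := hD i (Or.inl hi); omega
        · rcases List.mem_append.1 hg with hg | hg
          · have := hD i (Or.inr ⟨g, hg, hi⟩); omega
          · rw [List.mem_singleton] at hg
            subst hg
            exact hi.2)
    refine ⟨c ++ c', ?_, ?_, fun x hx => ?_⟩
    · rw [List.length_append, List.length_cons, Nat.succ_mul]
      omega
    · intro g hg
      rcases List.mem_append.1 hg with hg | hg
      · exact hok g hg
      · exact hok' g hg
    · rw [runWires_append, hrun x hx]
      obtain ⟨h1, h2⟩ := hrun' (xorReg o (2 * k) (E x) x) fun i hi hi' => by
        rw [xorReg_of_notMem (by omega)]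
        exact hx i hi hi'
      refine ⟨fun i hi => ?_, fun s hsl hs hdec hzero => ?_⟩
      · rw [h1 i (by omega), xorReg_of_notMem (by omega)]
      · have hsn : s.length ≤ n := hsl ▸ hr
        have hB : Holds o k (encReg n (roundSet F s i₀ (2 ^ e)))
            (xorReg o (2 * k) (E x) x) := by
          intro i hi
          rw [xorReg, if_pos (by omega), hzero _ (by omega) (by omega), hspec x s hsl hs hdec,
            Nat.add_sub_cancel_left, Bool.false_xor, regBits]
        rw [blocksEnc_cons]
        refine Holds.append (fun i hi => ?_) (length_encReg_roundSet F hsn (by omega))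
          (h2 s hsl (fun i hi => ?_) ?_ fun i hi hi' => ?_)
        · rw [h1 _ (by omega)]
          exact hB i hi
        · have := hD (0 + i) (Or.inl (by omega))
          rw [xorReg_of_notMem (by omega)]
          exact hs i hi
        · rw [decodeRegs_append_singleton, hB.decodeSet_roundSet hsn (by omega),
            decodeRegs_congr (y := x) fun g hg i hi => by
              have := hD i (Or.inr ⟨g, hg, hi⟩)
              exact xorReg_of_notMem (by omega), hdec]
          simpa using roundSet_union F s 0 i₀ (2 ^ e)
        · rw [xorReg_of_notMem (by omega)]
          exact hzero i (by omega) (by omega)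

/-- A circuit that leaves all wires from `q` on unchanged, if they are zero, implements a
bijection of `q` bits. -/
theorem exists_perm {q l : ℕ} (c : List WireGate) (hc : ∀ g ∈ c, g.Ok (q + l))
    (h : ∀ x : ℕ → Bool, (∀ i, q ≤ i → x i = false) → ∀ i, q ≤ i → runWires c x i = false) :
    ∃ f : Equiv.Perm (Fin q → Bool), ImplementableReversibly f l c.length ∧
      ∀ x : ℕ → Bool, (∀ i, q ≤ i → x i = false) →
        f (fun i => x i) = fun i : Fin q => runWires c x i := by
  set ext : (Fin q → Bool) → ℕ → Bool := fun x i => if h : i < q then x ⟨i, h⟩ else false with hext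
  have hext0 : ∀ x i, q ≤ i → ext x i = false := fun x i hi => dif_neg (by omega)
  have hext' : ∀ x (i : Fin q), ext x i = x i := fun x i => dif_pos i.2
  have hext_eq : ∀ x : ℕ → Bool, (∀ i, q ≤ i → x i = false) → ext (fun i => x i) = x := by
    intro x hx
    funext i
    rcases lt_or_ge i q with hi | hi
    · exact dif_pos hi
    · exact (hext0 (fun j : Fin q => x j) i hi).trans (hx i hi).symm
  -- All wires from `q` on end at zero, so equal outputs mean equal final states, and running
  -- backwards recovers the input.
  have hinj : Function.Injective fun (x : Fin q → Bool) (i : Fin q) => runWires c (ext x) i := by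
    intro x y hxy
    have h1 : runWires c (ext x) = runWires c (ext y) := by
      funext i
      rcases lt_or_ge i q with hi | hi
      · exact congrFun hxy ⟨i, hi⟩
      · rw [h _ (hext0 x) i hi, h _ (hext0 y) i hi]
    have h2 : ext x = ext y := by
      rw [← runWires_reverse hc (ext x), h1, runWires_reverse hc]
    funext i
    exact (hext' x i).symm.trans ((congrFun h2 i).trans (hext' y i))
  obtain ⟨c', hl, hrun⟩ := exists_circuit c hc
  refine ⟨Equiv.ofBijective _ (Finite.injective_iff_bijective.1 hinj), ⟨c', hl.le, fun x => ?_⟩,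
    fun x hx => ?_⟩
  · have h1 : ∀ (y : ℕ → Bool) (z : Fin q → Bool), (∀ i : Fin q, y i = z i) →
        (∀ i, q ≤ i → y i = false) → (fun i : Fin (q + l) => y i) = Fin.append z (zeros l) := by
      intro y z h1 h2
      funext i
      refine Fin.addCases (fun j => ?_) (fun j => ?_) i
      · rw [Fin.append_left]
        exact h1 j
      · rw [Fin.append_right]
        exact h2 _ (by simp)
    rw [← h1 (ext x) x (hext' x) (hext0 x), hrun]
    exact h1 _ _ (fun i => rfl) (h _ (hext0 x))
  · rw [Equiv.ofBijective_apply, hext_eq x hx]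

theorem length_bitIndices_le (r : ℕ) : r.bitIndices.length ≤ r := by
  have h := List.card_nsmul_le_sum (r.bitIndices.map (2 ^ ·)) 1 (by
    intro y hy
    obtain ⟨e, -, rfl⟩ := List.mem_map.1 hy
    exact Nat.one_le_two_pow)
  rw [Nat.sum_map_two_pow_bitIndices] at h
  simpa using h

theorem exists_effEnc {n r w T a Q : ℕ} (F : Formula n) (hr : r ≤ n) (hw : 2 ≤ w)
    (hT : ∀ e, 2 ^ e ≤ n → encLen n (2 ^ e) ≤ T) (hcap : (2 * n + T + 2) ^ 4 < 2 ^ w)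
    (ha : ∀ e, 2 ^ e ≤ r → blockAncillas n w e ≤ a)
    (hQ : ∀ e, 2 ^ e ≤ r → 8 ^ e * (2 ^ w * 2 ^ (8 * w * 31)) ≤ Q) :
    ∃ (f : Equiv.Perm (Fin (2 * r + 2 * effEncLen n r) → Bool)) (g : ℕ), g ≤ r * Q ∧
      ImplementableReversibly f a g ∧
      ∀ s : Fin r → Fin 3,
        f (Fin.append (tritReg r (List.ofFn s)) (zeros (2 * effEncLen n r))) =
          Fin.append (tritReg r (List.ofFn s))
            (tritReg (effEncLen n r) (effEnc F (List.ofFn s))) := by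
  set q := 2 * r + 2 * effEncLen n r with hq
  have hmem : ∀ e ∈ r.bitIndices.reverse, 2 ^ e ≤ r := fun e he =>
    Nat.two_pow_le_of_mem_bitIndices (List.mem_reverse.1 he)
  have hsum : (r.bitIndices.reverse.map fun e => encLen n (2 ^ e)).sum = effEncLen n r := by
    rw [effEncLen, blockSizes, List.map_map]
    rfl
  have hsize : (r.bitIndices.reverse.map (2 ^ ·)).sum = r := sum_blockSizes r
  obtain ⟨c, hl, hok, hrun⟩ := exists_blocks F hr hw hT hcap q r.bitIndices.reverse
    (fun e he => ha e (hmem e he)) (fun e he => hQ e (hmem e he)) 0 (by omega) [] (by simp)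
    (by simp) (2 * r) (by omega) (by rintro i (hi | ⟨g, hg, -⟩); exacts [hi, by simp at hg])
  simp only [hsum] at hrun
  obtain ⟨f, hf, hf'⟩ := exists_perm c hok fun x hx i hi => by
    rw [(hrun x fun i hi _ => hx i hi).1 i (by omega), hx i hi]
  refine ⟨f, c.length, hl.trans ?_, hf, fun s => ?_⟩
  · rw [List.length_reverse]
    exact Nat.mul_le_mul_right _ (length_bitIndices_le r)
  · set l := List.ofFn s with hls
    have hlr : l.length = r := by simp [hls]
    set x : ℕ → Bool := fun i => (l.flatMap tritBits).getD i false with hx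
    have hx0 : ∀ i, 2 * r ≤ i → x i = false := fun i hi =>
      List.getD_eq_default _ _ (by rw [length_flatMap_tritBits]; omega)
    have hxin : Fin.append (tritReg r l) (zeros (2 * effEncLen n r)) = fun i : Fin q => x i := by
      funext i
      refine Fin.addCases (fun j => ?_) (fun j => ?_) i
      · rw [Fin.append_left]
        rfl
      · rw [Fin.append_right]
        exact (hx0 _ (by simp)).symm
    rw [hxin, hf' x fun i hi => hx0 i (by omega)]
    obtain ⟨h1, h2⟩ := hrun x fun i hi _ => hx0 i (by omega)
    have h3 := h2 l hlr (fun i hi => by rw [Nat.zero_add]) (by simp [decodeRegs, roundSet])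
      fun i hi _ => hx0 i hi
    funext i
    refine Fin.addCases (fun j => ?_) (fun j => ?_) i
    · rw [Fin.append_left]
      exact h1 j (Or.inl j.2)
    · rw [Fin.append_right]
      refine (h3 j j.2).trans ?_
      rw [tritReg, effEnc, hlr, blockSizes, blocksEnc, List.drop_zero]


/-! ### Bounds -/

/-- The rounding error `1` is absorbed by `2 ^ e ≥ 1`, which turns the constant `4` into `5`. -/
theorem encLen_two_pow_le {n e : ℕ} (he : 2 ^ e ≤ n) :
    (encLen n (2 ^ e) : ℝ) ≤ 2 ^ e * (Real.logb 2 n - e + 5) := by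
  have hn : (0 : ℝ) < n := by exact_mod_cast (Nat.two_pow_pos e).trans_le he
  have hpow : (0 : ℝ) < 2 ^ e := by positivity
  have hone : (1 : ℝ) ≤ 2 ^ e := one_le_pow₀ (by norm_num)
  have hlog : Real.logb 2 ((n : ℝ) / ((2 ^ e : ℕ) : ℝ)) = Real.logb 2 n - e := by
    push_cast
    rw [Real.logb_div hn.ne' hpow.ne', Real.logb_pow, Real.logb_self_eq_one (by norm_num), mul_one]
  have hnonneg : (0 : ℝ) ≤ Real.logb 2 n - e := by
    rw [← hlog]
    refine Real.logb_nonneg (by norm_num) ?_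
    rw [one_le_div (by exact_mod_cast Nat.two_pow_pos e)]
    exact_mod_cast he
  have hceil := Nat.ceil_lt_add_one (mul_nonneg hpow.le hnonneg)
  rw [encLen, hlog]
  push_cast
  nlinarith

/-- The geometric weights beat the slow growth of `L - i` for small `i`, so the last term dominates.
With the constant `6` the induction step is an identity. -/
theorem sum_two_pow_mul (L : ℝ) (e : ℕ) (hL : 0 ≤ L) :
    ∑ i ∈ Finset.range (e + 1), (2 : ℝ) ^ i * (L - i + 5) ≤ 2 ^ (e + 1) * (L - e + 6) := by
  induction e with
  | zero => simp; linarith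
  | succ e ih =>
    rw [Finset.sum_range_succ]
    refine (add_le_add_left ih _).trans (le_of_eq ?_)
    push_cast
    ring

/-- The total length of registers for sets of sizes `1, 2, 4, …` up to `r`. -/
theorem sum_encLen_le {n r : ℕ} (hr0 : 0 < r) (hr : r ≤ n) :
    ∑ i ∈ Finset.range (Nat.log 2 r + 1), (encLen n (2 ^ i) : ℝ) ≤
      14 * (r * Real.logb 2 ((n : ℝ) / r) + r) := by
  set ρ := Nat.log 2 r with hρ
  have h1 : 2 ^ ρ ≤ r := Nat.pow_log_le_self 2 hr0.ne'
  have h2 : r < 2 ^ (ρ + 1) := Nat.lt_pow_succ_log_self (by norm_num) r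
  have hn : (1 : ℝ) ≤ n := by exact_mod_cast hr0.trans_le hr
  have hr' : (0 : ℝ) < r := by exact_mod_cast hr0
  have hL : 0 ≤ Real.logb 2 n := Real.logb_nonneg (by norm_num) hn
  have hdiv : Real.logb 2 ((n : ℝ) / r) = Real.logb 2 n - Real.logb 2 r :=
    Real.logb_div (by positivity) hr'.ne'
  have hdiv0 : 0 ≤ Real.logb 2 ((n : ℝ) / r) :=
    Real.logb_nonneg (by norm_num) (by rw [one_le_div hr']; exact_mod_cast hr)
  have hlog : Real.logb 2 r ≤ ρ + 1 := by
    rw [Real.logb_le_iff_le_rpow (by norm_num) hr']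
    have : (r : ℝ) ≤ 2 ^ (ρ + 1) := by exact_mod_cast h2.le
    exact_mod_cast this
  have hpow : (2 : ℝ) ^ (ρ + 1) ≤ 2 * r := by
    rw [pow_succ']
    have : (2 : ℝ) ^ ρ ≤ r := by exact_mod_cast h1
    linarith
  calc ∑ i ∈ Finset.range (ρ + 1), (encLen n (2 ^ i) : ℝ)
      ≤ ∑ i ∈ Finset.range (ρ + 1), (2 : ℝ) ^ i * (Real.logb 2 n - i + 5) := by
        refine Finset.sum_le_sum fun i hi => encLen_two_pow_le ?_
        rw [Finset.mem_range] at hi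
        exact (Nat.pow_le_pow_right (by norm_num) (by omega)).trans (h1.trans hr)
    _ ≤ 2 ^ (ρ + 1) * (Real.logb 2 n - ρ + 6) := sum_two_pow_mul _ _ hL
    -- Replacing `ρ` by `logb 2 r ≤ ρ + 1` costs `1`; the final constant is `14 = 2 * 7`.
    _ ≤ 2 ^ (ρ + 1) * (Real.logb 2 ((n : ℝ) / r) + 7) :=
        mul_le_mul_of_nonneg_left (by linarith) (by positivity)
    _ ≤ 2 * r * (Real.logb 2 ((n : ℝ) / r) + 7) := by gcongr
    _ ≤ 14 * (r * Real.logb 2 ((n : ℝ) / r) + r) := by nlinarith [mul_nonneg hr'.le hdiv0]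

theorem effEncLen_le {n r : ℕ} (hr0 : 0 < r) (hr : r ≤ n) :
    (effEncLen n r : ℝ) ≤ 14 * (r * Real.logb 2 ((n : ℝ) / r) + r) := by
  refine le_trans ?_ (sum_encLen_le hr0 hr)
  have h : effEncLen n r = ∑ i ∈ r.bitIndices.toFinset, encLen n (2 ^ i) := by
    rw [effEncLen, blockSizes, List.map_map, List.map_reverse, List.sum_reverse,
      List.sum_toFinset _ Nat.bitIndices_nodup]
    rfl
  rw [h, Nat.cast_sum]
  refine Finset.sum_le_sum_of_subset_of_nonneg (fun i hi => ?_) fun i _ _ => Nat.cast_nonneg _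
  rw [List.mem_toFinset] at hi
  rw [Finset.mem_range, Nat.lt_succ_iff]
  exact Nat.le_log_of_pow_le (by norm_num) (Nat.two_pow_le_of_mem_bitIndices hi)

theorem blockAncillas_eq (n w e : ℕ) :
    blockAncillas n w e = 31 * (2 * w + 1) + 4 * ∑ i ∈ Finset.range e, encLen n (2 ^ i) := by
  induction e with
  | zero => simp [blockAncillas]
  | succ e ih =>
    rw [blockAncillas, ih, Finset.sum_range_succ]
    ring

theorem blockAncillas_mono {n w e e' : ℕ} (h : e ≤ e') :
    blockAncillas n w e ≤ blockAncillas n w e' := by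
  rw [blockAncillas_eq, blockAncillas_eq]
  gcongr

theorem blockAncillas_log_le {n w r : ℕ} (hr0 : 0 < r) (hr : r ≤ n) :
    (blockAncillas n w (Nat.log 2 r) : ℝ) ≤
      31 * (2 * w + 1) + 56 * (r * Real.logb 2 ((n : ℝ) / r) + r) := by
  rw [blockAncillas_eq]
  have h := sum_encLen_le hr0 hr
  rw [Finset.sum_range_succ] at h
  have : (0 : ℝ) ≤ encLen n (2 ^ Nat.log 2 r) := Nat.cast_nonneg _
  push_cast
  linarith

theorem encLen_le {n k : ℕ} (hk : 0 < k) (hkn : k ≤ n) : encLen n k ≤ 5 * n := by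
  have hk' : (0 : ℝ) < k := by exact_mod_cast hk
  have hn : (0 : ℝ) < n := by exact_mod_cast hk.trans_le hkn
  -- Bernoulli gives `1 + y ≤ 2 ^ y` for `y ≥ 1`.
  have h1 : Real.logb 2 ((n : ℝ) / k) ≤ (n : ℝ) / k := by
    rw [Real.logb_le_iff_le_rpow (by norm_num) (by positivity)]
    have := one_add_mul_self_le_rpow_one_add (s := 1) (by norm_num) (p := (n : ℝ) / k)
      (by rw [one_le_div hk']; exact_mod_cast hkn)
    norm_num at this
    linarith
  have h2 : (k : ℝ) * Real.logb 2 ((n : ℝ) / k) ≤ n := by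
    calc (k : ℝ) * Real.logb 2 ((n : ℝ) / k) ≤ k * ((n : ℝ) / k) := by gcongr
      _ = n := by field_simp
  have h3 : ⌈(k : ℝ) * Real.logb 2 ((n : ℝ) / k)⌉₊ ≤ n := Nat.ceil_le.2 h2
  unfold encLen
  omega

end QBall

/-! ### Choice of the constants -/

theorem mainTheorem3 :
    ∃ (K : ℝ) (A d : ℕ), ∀ (n r : ℕ) (F : QBall.Formula n), r ≤ n →
      (2 * QBall.effEncLen n r : ℝ) ≤ K * (r * Real.logb 2 ((n : ℝ) / r) + r) ∧
      ∃ (f : Equiv.Perm (Fin (2 * r + 2 * QBall.effEncLen n r) → Bool)) (l g : ℕ),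
        (l : ℝ) ≤ K * (r * Real.logb 2 ((n : ℝ) / r) + r + Real.logb 2 n) ∧
        g ≤ A * n ^ d ∧
        QBall.ImplementableReversibly f l g ∧
        ∀ s : Fin r → Fin 3,
          f (Fin.append (QBall.tritReg r (List.ofFn s))
              (QBall.zeros (2 * QBall.effEncLen n r))) =
            Fin.append (QBall.tritReg r (List.ofFn s))
              (QBall.tritReg (QBall.effEncLen n r) (QBall.effEnc F (List.ofFn s))) := by
  -- The ancillas number at most `31 * (2 * w + 1) + 56 * X` with `w ≤ 20 + 4 * logb 2 n` and `X ≥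
  -- 1`, which `1400` covers. The exponent `249 = 1 + 8 * 31` counts the factors `2 ^ w ≤ (18 * n) ^
  -- 4` in the gate bound; `n ^ 4` comes from at most `r` blocks and `8 ^ e ≤ n ^ 3`.
  refine ⟨1400, 18 ^ (4 * 249), 4 + 4 * 249, fun n r F hr => ?_⟩
  -- Registers have at most `T = 5 * n` trits, so `2 * n + T + 2 = 7 * n + 2`, and four times its
  -- bit length covers the fourth power.
  set w := 4 * (7 * n + 2).size with hw
  have hsize : 1 ≤ (7 * n + 2).size := Nat.size_pos.2 (by omega)
  have hcap : (2 * n + 5 * n + 2) ^ 4 < 2 ^ w := by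
    rw [hw, mul_comm 4, pow_mul]
    have : 2 * n + 5 * n + 2 = 7 * n + 2 := by ring
    rw [this]
    exact Nat.pow_lt_pow_left (Nat.lt_size_self _) (by norm_num)
  have hT : ∀ e, 2 ^ e ≤ n → QBall.encLen n (2 ^ e) ≤ 5 * n := fun e he =>
    QBall.encLen_le (Nat.two_pow_pos e) he
  -- For `r = 0` there are no blocks, hence no gates or ancillas; the estimates below need `X ≥ 1`.
  rcases Nat.eq_zero_or_pos r with rfl | hr0
  · obtain ⟨f, g, h1, h2, h3⟩ := QBall.exists_effEnc (w := w) (a := 0) (Q := 0) F hr (by omega) hT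
      hcap (fun e he => by have := Nat.two_pow_pos e; omega)
      (fun e he => by have := Nat.two_pow_pos e; omega)
    refine ⟨by simp [QBall.effEncLen, QBall.blockSizes], f, 0, g, ?_, ?_, h2, h3⟩
    · have : 0 ≤ Real.logb 2 n := by
        rcases Nat.eq_zero_or_pos n with rfl | hn
        · simp
        · exact Real.logb_nonneg (by norm_num) (by exact_mod_cast hn)
      simp only [Nat.cast_zero, zero_mul, zero_add]
      positivity
    · rw [zero_mul] at h1
      exact h1.trans (Nat.zero_le _)
  · have hn : 0 < n := hr0.trans_le hr
    have hn' : (0 : ℝ) < n := by exact_mod_cast hn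
    have hr' : (1 : ℝ) ≤ r := by exact_mod_cast hr0
    have hpred : 2 ^ ((7 * n + 2).size - 1) ≤ 7 * n + 2 := Nat.lt_size.1 (by omega)
    have hsplit : (7 * n + 2).size = (7 * n + 2).size - 1 + 1 := by omega
    have hpow : 2 ^ w ≤ (18 * n) ^ 4 := by
      rw [hw, mul_comm 4, pow_mul]
      refine Nat.pow_le_pow_left ?_ 4
      rw [hsplit, pow_succ]
      omega
    have hwlog : (w : ℝ) ≤ 20 + 4 * Real.logb 2 n := by
      have h1 : (((7 * n + 2).size - 1 : ℕ) : ℝ) ≤ Real.logb 2 (16 * n) := by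
        rw [Real.le_logb_iff_rpow_le (by norm_num) (by positivity), Real.rpow_natCast]
        have : 2 ^ ((7 * n + 2).size - 1) ≤ 16 * n := by omega
        exact_mod_cast this
      have h2 : Real.logb 2 (16 * n) = 4 + Real.logb 2 n := by
        rw [Real.logb_mul (by norm_num) hn'.ne']
        have : Real.logb 2 (16 : ℝ) = 4 := by
          rw [Real.logb_eq_iff_rpow_eq (by norm_num) (by norm_num) (by norm_num)]
          norm_num
        rw [this]
      have h3 : (w : ℝ) = 4 * ((((7 * n + 2).size - 1 : ℕ) : ℝ) + 1) := by
        rw [hw]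
        conv_lhs => rw [hsplit]
        push_cast
        ring
      rw [h3]
      linarith
    set X := (r : ℝ) * Real.logb 2 ((n : ℝ) / r) + r with hX
    have hXr : (1 : ℝ) ≤ X := by
      have : 0 ≤ Real.logb 2 ((n : ℝ) / r) :=
        Real.logb_nonneg (by norm_num) (by rw [one_le_div (by linarith)]; exact_mod_cast hr)
      have : 0 ≤ (r : ℝ) * Real.logb 2 ((n : ℝ) / r) := by positivity
      linarith
    have hlogn : 0 ≤ Real.logb 2 n := Real.logb_nonneg (by norm_num) (by exact_mod_cast hn)
    obtain ⟨f, g, h1, h2, h3⟩ := QBall.exists_effEnc (w := w)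
      (a := QBall.blockAncillas n w (Nat.log 2 r)) (Q := n ^ 3 * (2 ^ w * 2 ^ (8 * w * 31))) F hr
      (by omega) hT hcap
      (fun e he => QBall.blockAncillas_mono (Nat.le_log_of_pow_le (by norm_num) he))
      (fun e he => by
        refine Nat.mul_le_mul_right _ ?_
        calc 8 ^ e = (2 ^ e) ^ 3 := by rw [← pow_mul, mul_comm, pow_mul]; norm_num
          _ ≤ n ^ 3 := Nat.pow_le_pow_left (he.trans hr) 3)
    refine ⟨?_, f, _, g, ?_, ?_, h2, h3⟩
    · have := QBall.effEncLen_le hr0 hr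
      rw [← hX] at this
      linarith
    · refine (QBall.blockAncillas_log_le hr0 hr).trans ?_
      rw [← hX]
      linarith
    · refine h1.trans ?_
      calc r * (n ^ 3 * (2 ^ w * 2 ^ (8 * w * 31)))
          ≤ n * (n ^ 3 * (2 ^ w * 2 ^ (8 * w * 31))) := Nat.mul_le_mul_right _ hr
        _ = n ^ 4 * (2 ^ w) ^ 249 := by
            have : 2 ^ w * 2 ^ (8 * w * 31) = (2 ^ w) ^ 249 := by
              rw [← pow_mul, ← pow_add]
              congr 1
              omega
            rw [this, pow_succ' n 3, mul_assoc]
        _ ≤ n ^ 4 * ((18 * n) ^ 4) ^ 249 := by gcongr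
        _ = 18 ^ (4 * 249) * n ^ (4 + 4 * 249) := by
            rw [← pow_mul, mul_pow, pow_add]
            exact mul_left_comm _ _ _
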